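/- **Lemma 7.1.** Let $\Bbbk$ be a field with $\operatorname{char}\Bbbk\ne 2$, and let $A=A_0\oplus A_1$ be a finitely generated super-commutative super Hopf algebra over $\Bbbk$ with coproduct $\Delta$, counit $\varepsilon$ and augmentation ideal $A^+=\operatorname{Ker}\varepsilon$; let $G=\mathrm{SSp}\,A$ be the super algebraic group it represents, so that $\mathcal O(G)=A$. Let $G_{ev}$ be the algebraic group with $\mathcal O(G_{ev})=A/(A_1)$, where $(A_1)$ is the ideal generated by $A_1$. Let $\mathrm{hy}(G)\subset A^*$ be the algebra, under the convolution product $(uv)(a)=\sum u(a_{(1)})v(a_{(2)})$, of all linear forms on $A$ that vanish on $(A^+)^n$ for some $n>0$, and define $\mathrm{hy}(G_{ev})\subset (A/(A_1))^*$ in the same way. For an algebra $B$ let $B^\circ\subset B^*$ be the dual coalgebra of $B$, that is, the space of linear forms that vanish on some two-sided ideal of finite codimension, with the coproduct given by $f(xy)=\sum f_{(1)}(x)f_{(2)}(y)$. The projection $\mathcal O(G)\to\mathcal O(G_{ev})$ induces an inclusion of algebras $\mathrm{hy}(G_{ev})\subset\mathrm{hy}(G)$, hence by restriction a coalgebra map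 $\mathrm{hy}(G)^\circ\to\mathrm{hy}(G_{ev})^\circ$, along which $\mathrm{hy}(G)^\circ$ is regarded as a left $\mathrm{hy}(G_{ev})^\circ$-comodule. Suppose that $G$ is connected, i.e. that $\operatorname{Spec}(A_0)$ is connected. Then the natural coalgebra maps $\mathcal O(G)\to\mathrm{hy}(G)^\circ$ and $\mathcal O(G_{ev})\to\mathrm{hy}(G_{ev})^\circ$, $a\mapsto(u\mapsto u(a))$, are injective, and, if they are regarded as inclusions, $\mathcal O(G)$ is the largest $\mathcal O(G_{ev})$-subcomodule of the left $\mathrm{hy}(G_{ev})^\circ$-comodule $\mathrm{hy}(G)^\circ$. In other words, with $\lambda:\mathrm{hy}(G)^\circ\to\mathrm{hy}(G_{ev})^\circ\otimes\mathrm{hy}(G)^\circ$ the coaction, $\mathcal O(G)$ is the largest among the subspaces $N\subset\mathrm{hy}(G)^\circ$ such that $\lambda(N)\subset\mathcal O(G_{ev})\otimes N$. -/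

import Mathlib

open scoped TensorProduct

noncomputable section

namespace SuperGroup

/-! ### The dual coalgebra of an algebra -/

section FiniteDual

variable (k : Type*) [Field k] (B : Type*) [Ring B] [Algebra k B]

/-- The dual coalgebra `B°` of a `k`-algebra `B`: the linear forms on `B` which vanish on some
two-sided ideal of finite codimension. -/
def FiniteDual : Submodule k (Module.Dual k B) where
  carrier := {f | ∃ I : Ideal B, I.IsTwoSided ∧ Module.Finite k (B ⧸ I) ∧ ∀ x ∈ I, f x = 0}
  zero_mem' := by
    refine ⟨⊤, inferInstance, ?_, fun _ _ => rfl⟩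
    have : Subsingleton (B ⧸ (⊤ : Ideal B)) := Submodule.Quotient.subsingleton_iff.2 rfl
    infer_instance
  add_mem' := by
    rintro f g ⟨I, hI, hI', hf⟩ ⟨J, hJ, hJ', hg⟩
    refine ⟨I ⊓ J, ⟨fun b hx => ⟨I.mul_mem_right b hx.1, J.mul_mem_right b hx.2⟩⟩, ?_, fun x hx => by
      rw [LinearMap.add_apply, hf x hx.1, hg x hx.2, add_zero]⟩
    let φ : B →ₗ[k] (B ⧸ I) × (B ⧸ J) :=
      ((I.mkQ.restrictScalars k).prod (J.mkQ.restrictScalars k))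
    have hker : (I ⊓ J).restrictScalars k = LinearMap.ker φ := by
      ext x
      simp [φ]
    have : Module.Finite k (B ⧸ ((I ⊓ J).restrictScalars k)) := by
      rw [hker]
      exact Module.Finite.equiv φ.quotKerEquivRange.symm
    exact this
  smul_mem' := by
    rintro c f ⟨I, hI, hI', hf⟩
    exact ⟨I, hI, hI', fun x hx => by rw [LinearMap.smul_apply, hf x hx, smul_zero]⟩

variable {k B}

theorem mem_finiteDual_iff (f : Module.Dual k B) :
    f ∈ FiniteDual k B ↔
      ∃ I : Ideal B, I.IsTwoSided ∧ Module.Finite k (B ⧸ I) ∧ ∀ x ∈ I, f x = 0 := Iff.rfl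

/-- A linear form `f` lies in `B°` if the values `f (h * u * h')` only depend on the image of `u`
in a finite-dimensional vector space. -/
theorem mem_finiteDual_of_forall {V : Type*} [AddCommGroup V] [Module k V] [Module.Finite k V]
    (f : Module.Dual k B) (φ : B →ₗ[k] V)
    (h : ∀ u, φ u = 0 → ∀ h h' : B, f (h * u * h') = 0) : f ∈ FiniteDual k B := by
  let I : Ideal B :=
    { carrier := {u | ∀ h h' : B, f (h * u * h') = 0}
      zero_mem' := fun h h' => by simp
      add_mem' := fun {u v} hu hv h h' => by
        rw [mul_add, add_mul, map_add, hu, hv, add_zero]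
      smul_mem' := fun c u hu h h' => by
        rw [smul_eq_mul, ← mul_assoc]
        exact hu (h * c) h' }
  have hI : I.IsTwoSided := ⟨fun b hu h h' => by
    rw [← mul_assoc, mul_assoc]
    exact hu h (b * h')⟩
  refine ⟨I, hI, ?_, fun u hu => by simpa using hu 1 1⟩
  have hφ : LinearMap.ker φ ≤ I.restrictScalars k := fun u hu => h u hu
  have : Module.Finite k (B ⧸ LinearMap.ker φ) := Module.Finite.equiv φ.quotKerEquivRange.symm
  have : Module.Finite k (B ⧸ I.restrictScalars k) :=
    Module.Finite.of_surjective (Submodule.factor hφ) (Submodule.factor_surjective hφ)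
  exact this

end FiniteDual

section Pairing

variable {k : Type*} [Field k] {V W M N : Type*} [AddCommMonoid V] [Module k V]
  [AddCommMonoid W] [Module k W] [AddCommMonoid M] [Module k M] [AddCommMonoid N] [Module k N]

/-- The linear form on `M ⊗ N` given by an element of `V ⊗ W`, when elements of `V`, `W` act as
linear forms on `M`, `N`: `⟨v ⊗ w, m ⊗ n⟩ = ⟨v, m⟩ ⟨w, n⟩`. -/
def pairing (e : V →ₗ[k] Module.Dual k M) (e' : W →ₗ[k] Module.Dual k N) :
    V ⊗[k] W →ₗ[k] Module.Dual k (M ⊗[k] N) :=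
  TensorProduct.dualDistrib k M N ∘ₗ TensorProduct.map e e'

@[simp]
theorem pairing_tmul (e : V →ₗ[k] Module.Dual k M) (e' : W →ₗ[k] Module.Dual k N)
    (v : V) (w : W) (m : M) (n : N) :
    pairing e e' (v ⊗ₜ w) (m ⊗ₜ n) = e v m * e' w n := rfl

theorem pairing_injective {e : V →ₗ[k] Module.Dual k M} {e' : W →ₗ[k] Module.Dual k N}
    (he : Function.Injective e) (he' : Function.Injective e') :
    Function.Injective (pairing e e') := by
  classical
  let _ : AddCommGroup V := Module.addCommMonoidToAddCommGroup k
  let _ : AddCommGroup W := Module.addCommMonoidToAddCommGroup k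
  rw [injective_iff_map_eq_zero]
  intro t ht
  let b := Module.Basis.ofVectorSpace k V
  apply (TensorProduct.equivFinsuppOfBasisLeft (N := W) b).injective
  rw [map_zero]
  set s := TensorProduct.equivFinsuppOfBasisLeft (N := W) b t with hs
  have hts : t = s.sum fun i w => b i ⊗ₜ[k] w := by
    rw [← TensorProduct.equivFinsuppOfBasisLeft_symm_apply, hs, LinearEquiv.symm_apply_apply]
  ext1 i
  apply he'
  rw [Finsupp.zero_apply, map_zero]
  ext n
  have h0 : ∑ i ∈ s.support, (e' (s i) n) • b i = 0 := by
    apply he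
    rw [map_zero]
    ext m
    have := LinearMap.congr_fun ht (m ⊗ₜ n)
    rw [hts, Finsupp.sum, map_sum, LinearMap.sum_apply] at this
    simpa [mul_comm] using this
  have := linearIndependent_iff'.1 b.linearIndependent s.support (fun i => e' (s i) n) h0
  by_cases hi : i ∈ s.support
  · simpa using this i hi
  · simp [Finsupp.notMem_support_iff.1 hi]

end Pairing

namespace FiniteDual

variable {k : Type*} [Field k] {B : Type*} [Ring B] [Algebra k B]

variable (k B) in
/-- The embedding of `B° ⊗ B°` into the linear forms on `B ⊗ B`. -/
def pair : FiniteDual k B ⊗[k] FiniteDual k B →ₗ[k] Module.Dual k (B ⊗[k] B) :=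
  pairing (FiniteDual k B).subtype (FiniteDual k B).subtype

@[simp]
theorem pair_tmul (f g : FiniteDual k B) (x y : B) :
    pair k B (f ⊗ₜ g) (x ⊗ₜ y) = f.1 x * g.1 y := rfl

theorem pair_injective : Function.Injective (pair k B) :=
  pairing_injective (Submodule.subtype_injective _) (Submodule.subtype_injective _)

theorem comp_mul_mem (f : FiniteDual k B) :
    f.1 ∘ₗ LinearMap.mul' k B ∈ LinearMap.range (pair k B) := by
  obtain ⟨f, I, hI, hfin, hf⟩ := f
  let q : B →ₐ[k] B ⧸ I := Ideal.Quotient.mkₐ k I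
  let fbar : (B ⧸ I) →ₗ[k] k := (I.restrictScalars k).liftQ f hf
  have hfbar : ∀ x, fbar (q x) = f x := fun x => rfl
  let r : Module.Dual k (B ⧸ I) →ₗ[k] FiniteDual k B :=
    LinearMap.codRestrict _ (q.toLinearMap.dualMap) (fun g => ⟨I, hI, hfin, fun x hx => by
      have : q x = 0 := Ideal.Quotient.eq_zero_iff_mem.2 hx
      simp [this]⟩)
  refine ⟨TensorProduct.map r r ((TensorProduct.dualDistribEquiv k (B ⧸ I) (B ⧸ I)).symm
    (fbar ∘ₗ LinearMap.mul' k (B ⧸ I))), ?_⟩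
  have key : pair k B ∘ₗ TensorProduct.map r r =
      (TensorProduct.map q.toLinearMap q.toLinearMap).dualMap ∘ₗ
        TensorProduct.dualDistrib k (B ⧸ I) (B ⧸ I) := by
    ext g h x y
    rfl
  have := LinearMap.congr_fun key ((TensorProduct.dualDistribEquiv k (B ⧸ I) (B ⧸ I)).symm
    (fbar ∘ₗ LinearMap.mul' k (B ⧸ I)))
  rw [LinearMap.comp_apply] at this
  rw [this, LinearMap.comp_apply]
  have e : TensorProduct.dualDistrib k (B ⧸ I) (B ⧸ I)
      ((TensorProduct.dualDistribEquiv k (B ⧸ I) (B ⧸ I)).symm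
        (fbar ∘ₗ LinearMap.mul' k (B ⧸ I))) = fbar ∘ₗ LinearMap.mul' k (B ⧸ I) :=
    (TensorProduct.dualDistribEquiv k (B ⧸ I) (B ⧸ I)).apply_symm_apply _
  rw [e]
  ext x y
  simp [← map_mul, hfbar]

/-- The coproduct of `B°`, dual to the product of `B`: it sends `f` to the unique element
`∑ fᵢ ⊗ gᵢ` with `f (x y) = ∑ fᵢ x * gᵢ y`. -/
def comulMap : FiniteDual k B →ₗ[k] FiniteDual k B ⊗[k] FiniteDual k B :=
  (LinearEquiv.ofInjective (pair k B) pair_injective).symm.toLinearMap ∘ₗ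
    LinearMap.codRestrict (LinearMap.range (pair k B))
      ((LinearMap.mul' k B).dualMap ∘ₗ (FiniteDual k B).subtype) comp_mul_mem

theorem pair_comulMap (f : FiniteDual k B) :
    pair k B (comulMap f) = f.1 ∘ₗ LinearMap.mul' k B := by
  have := LinearEquiv.ofInjective_apply (pair k B) (h := pair_injective) (comulMap f)
  rw [← this]
  simp only [comulMap, LinearMap.comp_apply, LinearEquiv.coe_coe, LinearEquiv.apply_symm_apply]
  rfl

@[simp]
theorem pair_comulMap_tmul (f : FiniteDual k B) (x y : B) :
    pair k B (comulMap f) (x ⊗ₜ y) = f.1 (x * y) := by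
  rw [pair_comulMap]; rfl

variable (k B) in
/-- The counit of `B°`: evaluation at `1`. -/
def counitMap : FiniteDual k B →ₗ[k] k :=
  LinearMap.applyₗ (1 : B) ∘ₗ (FiniteDual k B).subtype

@[simp]
theorem counitMap_apply (f : FiniteDual k B) : counitMap k B f = f.1 1 := rfl

instance instCoalgebra : Coalgebra k (FiniteDual k B) where
  comul := comulMap
  counit := counitMap k B
  coassoc := by
    ext1 f
    apply pairing_injective (Submodule.subtype_injective (FiniteDual k B)) (pair_injective)
    have h1 : ∀ (t : FiniteDual k B ⊗[k] FiniteDual k B) (x y z : B),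
        pairing (FiniteDual k B).subtype (pair k B)
          (TensorProduct.assoc k _ _ _ (comulMap.rTensor _ t)) (x ⊗ₜ (y ⊗ₜ z)) =
        pair k B t ((x * y) ⊗ₜ z) := by
      intro t x y z
      induction t with
      | zero => simp
      | add a b ha hb => simp [ha, hb]
      | tmul f g =>
        rw [LinearMap.rTensor_tmul, pair_tmul, ← pair_comulMap_tmul]
        induction comulMap f with
        | zero => simp
        | add a b ha hb => simp [TensorProduct.add_tmul, ha, hb, add_mul]
        | tmul a b => simp [mul_assoc]
    have h2 : ∀ (t : FiniteDual k B ⊗[k] FiniteDual k B) (x y z : B),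
        pairing (FiniteDual k B).subtype (pair k B)
          (comulMap.lTensor _ t) (x ⊗ₜ (y ⊗ₜ z)) =
        pair k B t (x ⊗ₜ (y * z)) := by
      intro t x y z
      induction t with
      | zero => simp
      | add a b ha hb => simp [ha, hb]
      | tmul f g => simp
    ext x y z
    simp only [LinearMap.comp_apply, TensorProduct.AlgebraTensorModule.curry_apply,
      LinearMap.restrictScalars_self, TensorProduct.curry_apply, LinearEquiv.coe_coe]
    rw [h1, h2, pair_comulMap_tmul, pair_comulMap_tmul, mul_assoc]
  rTensor_counit_comp_comul := by
    ext1 f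
    apply (TensorProduct.lid k _).injective
    have h : ∀ (t : FiniteDual k B ⊗[k] FiniteDual k B) (z : B),
        (TensorProduct.lid k _ ((counitMap k B).rTensor _ t)).1 z = pair k B t (1 ⊗ₜ z) := by
      intro t z
      induction t with
      | zero => simp
      | add a b ha hb => simp [ha, hb]
      | tmul f g => simp
    ext z
    rw [LinearMap.comp_apply, h]
    simp
  lTensor_counit_comp_comul := by
    ext1 f
    apply (TensorProduct.rid k _).injective
    have h : ∀ (t : FiniteDual k B ⊗[k] FiniteDual k B) (z : B),
        (TensorProduct.rid k _ ((counitMap k B).lTensor _ t)).1 z = pair k B t (z ⊗ₜ 1) := by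
      intro t z
      induction t with
      | zero => simp
      | add a b ha hb => simp [ha, hb]
      | tmul f g => simp [mul_comm]
    ext z
    rw [LinearMap.comp_apply, h]
    simp

@[simp]
theorem pair_comul_tmul (f : FiniteDual k B) (x y : B) :
    pair k B (Coalgebra.comul (R := k) f) (x ⊗ₜ y) = f.1 (x * y) := pair_comulMap_tmul f x y

@[simp]
theorem counit_apply (f : FiniteDual k B) : Coalgebra.counit (R := k) f = f.1 1 := rfl

variable {C : Type*} [Ring C] [Algebra k C]

/-- The coalgebra map `C° → B°`, `f ↦ f ∘ φ`, induced by an algebra map `φ : B → C`. -/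
def map (φ : B →ₐ[k] C) : FiniteDual k C →ₗc[k] FiniteDual k B where
  toLinearMap := LinearMap.codRestrict _ (φ.toLinearMap.dualMap ∘ₗ (FiniteDual k C).subtype) (by
    rintro ⟨f, I, hI, hfin, hf⟩
    refine ⟨I.comap φ, inferInstance, ?_, fun x hx => hf _ hx⟩
    let ψ : B →ₗ[k] (C ⧸ I) := (I.mkQ.restrictScalars k) ∘ₗ φ.toLinearMap
    have hker : (I.comap φ).restrictScalars k = LinearMap.ker ψ := by
      ext x
      exact (Submodule.Quotient.mk_eq_zero I).symm
    have : Module.Finite k (B ⧸ ((I.comap φ).restrictScalars k)) := by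
      rw [hker]
      exact Module.Finite.equiv ψ.quotKerEquivRange.symm
    exact this)
  counit_comp := by
    ext f
    simp
  map_comp_comul := by
    ext1 f
    apply pair_injective
    have h : ∀ (r : FiniteDual k C →ₗ[k] FiniteDual k B) (_ : ∀ f x, (r f).1 x = f.1 (φ x))
        (t : FiniteDual k C ⊗[k] FiniteDual k C) (x y : B),
        pair k B (TensorProduct.map r r t) (x ⊗ₜ y) = pair k C t (φ x ⊗ₜ φ y) := by
      intro r hr t x y
      induction t with
      | zero => simp
      | add a b ha hb => simp [ha, hb]
      | tmul f g => simp [hr]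
    ext x y
    simp only [LinearMap.comp_apply, TensorProduct.AlgebraTensorModule.curry_apply,
      LinearMap.restrictScalars_self, TensorProduct.curry_apply]
    rw [h _ (fun _ _ => rfl), pair_comul_tmul, pair_comul_tmul]
    simp

@[simp]
theorem map_apply (φ : B →ₐ[k] C) (f : FiniteDual k C) (x : B) : (map φ f).1 x = f.1 (φ x) := rfl

end FiniteDual

/-! ### Comodules -/

section Comodule

variable {k : Type*} [Field k]

/-- A left comodule structure on `M` over the coalgebra `C`. -/
structure LeftComodule (k : Type*) [Field k] (C M : Type*) [AddCommMonoid C] [Module k C]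
    [Coalgebra k C] [AddCommMonoid M] [Module k M] where
  /-- the coaction -/
  coact : M →ₗ[k] C ⊗[k] M
  coassoc : (TensorProduct.assoc k C C M).toLinearMap ∘ₗ Coalgebra.comul.rTensor M ∘ₗ coact =
    coact.lTensor C ∘ₗ coact
  counit_coact : Coalgebra.counit.rTensor M ∘ₗ coact = TensorProduct.mk k k M 1

variable {C D M : Type*} [AddCommMonoid C] [Module k C] [Coalgebra k C]
  [AddCommMonoid D] [Module k D] [Coalgebra k D] [AddCommMonoid M] [Module k M]

/-- A coalgebra `D` regarded as a left `C`-comodule along a coalgebra map `φ : D → C`, with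
coaction `d ↦ ∑ φ d₍₁₎ ⊗ d₍₂₎`. -/
def LeftComodule.ofCoalgHom (φ : D →ₗc[k] C) : LeftComodule k C D where
  coact := φ.toLinearMap.rTensor D ∘ₗ Coalgebra.comul
  coassoc := by
    have e1 : Coalgebra.comul.rTensor D ∘ₗ φ.toLinearMap.rTensor D =
        (TensorProduct.map φ.toLinearMap φ.toLinearMap).rTensor D ∘ₗ
          (Coalgebra.comul (R := k) (A := D)).rTensor D := by
      rw [← LinearMap.rTensor_comp, ← LinearMap.rTensor_comp, φ.map_comp_comul]
    have e2 : (TensorProduct.assoc k C C D).toLinearMap ∘ₗ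
        (TensorProduct.map φ.toLinearMap φ.toLinearMap).rTensor D =
        TensorProduct.map φ.toLinearMap (φ.toLinearMap.rTensor D) ∘ₗ
          (TensorProduct.assoc k D D D).toLinearMap := by
      ext; rfl
    have e3 : (φ.toLinearMap.rTensor D ∘ₗ Coalgebra.comul).lTensor C ∘ₗ
        φ.toLinearMap.rTensor D = TensorProduct.map φ.toLinearMap (φ.toLinearMap.rTensor D) ∘ₗ
          (Coalgebra.comul (R := k) (A := D)).lTensor D := by
      ext; rfl
    rw [← LinearMap.comp_assoc (Coalgebra.comul), e1, LinearMap.comp_assoc,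
      ← LinearMap.comp_assoc _ _ (TensorProduct.assoc k C C D).toLinearMap, e2,
      LinearMap.comp_assoc, Coalgebra.coassoc, ← LinearMap.comp_assoc, ← LinearMap.comp_assoc, e3]
  counit_coact := by
    rw [← LinearMap.comp_assoc, ← LinearMap.rTensor_comp, φ.counit_comp,
      Coalgebra.rTensor_counit_comp_comul]

/-- Let `ι : D → C` be an injective coalgebra map, by which `D` is regarded as a subcoalgebra
of `C`. A `D`-subcomodule of a left `C`-comodule `M` is a subspace `N` of `M` such that the
coaction maps `N` into `D ⊗ N ⊆ C ⊗ M`. -/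
def LeftComodule.IsSubcomoduleOver (X : LeftComodule k C M) (ι : D →ₗc[k] C)
    (N : Submodule k M) : Prop :=
  ∀ n ∈ N, X.coact n ∈ LinearMap.range (TensorProduct.map ι.toLinearMap N.subtype)

end Comodule

/-! ### Super Hopf algebras -/

section Super

variable {k : Type*} [Field k] {A : Type*} [Ring A] [Algebra k A]

/-- A super algebra `A = A₀ ⊕ A₁` (an algebra graded by `ℤ/2`) is super-commutative if even elements
are central and odd elements anti-commute with each other. -/
class SuperCommutative (𝒜 : ZMod 2 → Submodule k A) : Prop where
  even_comm : ∀ a ∈ 𝒜 0, ∀ b, a * b = b * a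
  odd_anticomm : ∀ a ∈ 𝒜 1, ∀ b ∈ 𝒜 1, a * b = -(b * a)

/-- The degree `i` component `⨁_{j + l = i} Aⱼ ⊗ Aₗ` of `A ⊗ A`. -/
def tensorDegree (𝒜 : ZMod 2 → Submodule k A) (i : ZMod 2) : Submodule k (A ⊗[k] A) :=
  ⨆ j : ZMod 2, LinearMap.range (TensorProduct.map (𝒜 j).subtype (𝒜 (i - j)).subtype)

/-- A super bialgebra: a super algebra with a coalgebra structure whose coproduct
`A → A ⊗ A` and counit `A → k` are graded algebra maps. Here the algebra `A ⊗ A`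
(`GradedTensorProduct`) has the product
`(a ⊗ b) (c ⊗ d) = (-1) ^ (|b| |c|) (a c ⊗ b d)`. -/
class IsSuperBialgebra (𝒜 : ZMod 2 → Submodule k A) [GradedAlgebra 𝒜] [Coalgebra k A] : Prop where
  counit_one : Coalgebra.counit (R := k) (1 : A) = 1
  counit_mul : ∀ a b : A, Coalgebra.counit (R := k) (a * b) =
    Coalgebra.counit (R := k) a * Coalgebra.counit (R := k) b
  counit_odd : ∀ a ∈ 𝒜 1, Coalgebra.counit (R := k) a = 0
  comul_one : Coalgebra.comul (R := k) (1 : A) = 1 ⊗ₜ 1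
  comul_mul : ∀ a b : A,
    GradedTensorProduct.of k 𝒜 𝒜 (Coalgebra.comul (R := k) (a * b)) =
      GradedTensorProduct.of k 𝒜 𝒜 (Coalgebra.comul (R := k) a) *
        GradedTensorProduct.of k 𝒜 𝒜 (Coalgebra.comul (R := k) b)
  comul_degree : ∀ i, ∀ a ∈ 𝒜 i, Coalgebra.comul (R := k) a ∈ tensorDegree 𝒜 i

/-- A super Hopf algebra: a super bialgebra which has a (necessarily unique) antipode. -/
class IsSuperHopfAlgebra (𝒜 : ZMod 2 → Submodule k A) [GradedAlgebra 𝒜] [Coalgebra k A] : Prop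
    extends IsSuperBialgebra 𝒜 where
  exists_antipode : ∃ S : A →ₗ[k] A, (∀ i, ∀ a ∈ 𝒜 i, S a ∈ 𝒜 i) ∧
    (LinearMap.mul' k A ∘ₗ S.rTensor A ∘ₗ Coalgebra.comul =
      Algebra.linearMap k A ∘ₗ Coalgebra.counit) ∧
    (LinearMap.mul' k A ∘ₗ S.lTensor A ∘ₗ Coalgebra.comul =
      Algebra.linearMap k A ∘ₗ Coalgebra.counit)

/-! ### Purely even super bialgebras -/

section PurelyEven

variable (k A) in
/-- The grading of a purely even super algebra: `A₀ = A`, `A₁ = 0`. -/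
def evenGrading : ZMod 2 → Submodule k A := fun i => if i = 0 then ⊤ else ⊥

@[simp] theorem evenGrading_zero : evenGrading k A 0 = ⊤ := rfl

@[simp] theorem evenGrading_one : evenGrading k A 1 = ⊥ := rfl

instance : SetLike.GradedMonoid (evenGrading k A) where
  one_mem := by simp
  mul_mem := by
    intro i j a b ha hb
    fin_cases i <;> fin_cases j
    · exact Submodule.mem_top
    · have : b = 0 := hb
      subst this
      rw [mul_zero]; exact zero_mem _
    · have : a = 0 := ha
      subst this
      rw [zero_mul]; exact zero_mem _
    · have : b = 0 := hb
      subst this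
      rw [mul_zero]; exact zero_mem _

instance : GradedAlgebra (evenGrading k A) where
  decompose' a := DirectSum.of (fun i => evenGrading k A i) 0 ⟨a, Submodule.mem_top⟩
  left_inv a := DirectSum.coeAddMonoidHom_of (evenGrading k A) 0 ⟨a, Submodule.mem_top⟩
  right_inv x := by
    induction x using DirectSum.induction_on with
    | zero =>
      rw [map_zero]
      exact map_zero (DirectSum.of (fun i => evenGrading k A i) 0)
    | of i x =>
      rw [DirectSum.coeAddMonoidHom_of]
      fin_cases i
      · rfl
      · have : x = 0 := Subtype.ext x.2
        subst this
        rw [map_zero]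
        exact map_zero (DirectSum.of (fun i => evenGrading k A i) 0)
    | add x y hx hy =>
      rw [map_add]
      conv_rhs => rw [← hx, ← hy]
      exact map_add (DirectSum.of (fun i => evenGrading k A i) 0) ⟨_, Submodule.mem_top⟩
        ⟨_, Submodule.mem_top⟩

/-- An ordinary bialgebra is a purely even super bialgebra. -/
instance {B : Type*} [Ring B] [Bialgebra k B] : IsSuperBialgebra (evenGrading k B) where
  counit_one := Bialgebra.counit_one
  counit_mul := Bialgebra.counit_mul
  counit_odd := by
    intro a ha
    have : a = 0 := ha
    subst this
    exact map_zero _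
  comul_one := Bialgebra.comul_one
  comul_mul := by
    intro a b
    rw [Bialgebra.comul_mul]
    have : ∀ s t : B ⊗[k] B, GradedTensorProduct.of k (evenGrading k B) (evenGrading k B) (s * t) =
        GradedTensorProduct.of k (evenGrading k B) (evenGrading k B) s *
        GradedTensorProduct.of k (evenGrading k B) (evenGrading k B) t := by
      intro s t
      induction s with
      | zero => rw [zero_mul, map_zero, zero_mul]
      | add x y hx hy => rw [add_mul, map_add, hx, hy, map_add, add_mul]
      | tmul a b =>
        induction t with
        | zero => rw [mul_zero, map_zero, mul_zero]
        | add x y hx hy => rw [mul_add, map_add, hx, hy, map_add, mul_add]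
        | tmul c d =>
          rw [Algebra.TensorProduct.tmul_mul_tmul]
          exact (GradedTensorProduct.tmul_coe_mul_zero_coe_tmul (evenGrading k B)
            (evenGrading k B) a (⟨b, Submodule.mem_top⟩ : evenGrading k B 0)
            (⟨c, Submodule.mem_top⟩ : evenGrading k B 0) d).symm
    exact this _ _
  comul_degree := by
    intro i a ha
    fin_cases i
    · have h : LinearMap.range (TensorProduct.map (evenGrading k B 0).subtype
          (evenGrading k B (0 - 0)).subtype) = ⊤ := by
        rw [LinearMap.range_eq_top]
        exact TensorProduct.map_surjective (fun x => ⟨⟨x, Submodule.mem_top⟩, rfl⟩)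
          (fun x => ⟨⟨x, by rw [sub_zero]; exact Submodule.mem_top⟩, rfl⟩)
      refine Submodule.mem_iSup_of_mem 0 ?_
      exact h ▸ Submodule.mem_top
    · have : a = 0 := ha
      subst this
      rw [map_zero]
      exact zero_mem _

end PurelyEven

/-! ### The super hyperalgebra -/

section Hyperalgebra

variable (k A) in
/-- The augmentation ideal `A⁺ = Ker ε`. -/
def augIdeal [Coalgebra k A] : Submodule k A := LinearMap.ker (Coalgebra.counit (R := k) (A := A))

theorem mem_augIdeal [Coalgebra k A] {a : A} : a ∈ augIdeal k A ↔ Coalgebra.counit (R := k) a = 0 := Iff.rfl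

variable (𝒜 : ZMod 2 → Submodule k A) [GradedAlgebra 𝒜]

/-- The subspace is spanned by homogeneous elements. -/
def HomSpanned (P : Submodule k A) : Prop :=
  ∃ s : Set A, s ⊆ SetLike.homogeneousSubmonoid 𝒜 ∧ P = Submodule.span k s

open scoped Pointwise in
theorem HomSpanned.mul {P Q : Submodule k A} (hP : HomSpanned 𝒜 P) (hQ : HomSpanned 𝒜 Q) :
    HomSpanned 𝒜 (P * Q) := by
  obtain ⟨s, hs, rfl⟩ := hP
  obtain ⟨t, ht, rfl⟩ := hQ
  refine ⟨s * t, ?_, Submodule.span_mul_span ..⟩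
  rintro _ ⟨a, ha, b, hb, rfl⟩
  exact mul_mem (hs ha) (ht hb)

theorem homSpanned_of_forall {P : Submodule k A}
    (h : ∀ a ∈ P, ∀ i, (DirectSum.decompose 𝒜 a i : A) ∈ P) : HomSpanned 𝒜 P := by
  refine ⟨P ∩ SetLike.homogeneousSubmonoid 𝒜, Set.inter_subset_right, le_antisymm ?_
    (Submodule.span_le.2 Set.inter_subset_left)⟩
  intro a ha
  classical
  rw [← DirectSum.sum_support_decompose 𝒜 a]
  exact Submodule.sum_mem _ fun i _ =>
    Submodule.subset_span ⟨h a ha i, ⟨i, (DirectSum.decompose 𝒜 a i).2⟩⟩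

theorem homSpanned_top : HomSpanned 𝒜 (⊤ : Submodule k A) :=
  homSpanned_of_forall 𝒜 fun _ _ _ => Submodule.mem_top

theorem eq_even_add_odd (a : A) :
    a = (DirectSum.decompose 𝒜 a 0 : A) + (DirectSum.decompose 𝒜 a 1 : A) := by
  classical
  have h : ∑ i : ZMod 2, (DirectSum.decompose 𝒜 a i : A) = a := by
    rw [← Finset.sum_subset (Finset.subset_univ (DirectSum.decompose 𝒜 a).support)]
    · exact DirectSum.sum_support_decompose 𝒜 a
    · intro i _ hi
      rw [DFinsupp.notMem_support_iff.1 hi]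
      rfl
  exact h.symm.trans (Fin.sum_univ_two (fun i : ZMod 2 => (DirectSum.decompose 𝒜 a i : A)))

/-- The subspace `P ⊗ Q` of the super algebra `A ⊗ A`. -/
def tensorSub (P Q : Submodule k A) : Submodule k (GradedTensorProduct k 𝒜 𝒜) :=
  Submodule.map₂ ((TensorProduct.mk k A A).compr₂ (GradedTensorProduct.of k 𝒜 𝒜).toLinearMap) P Q

open scoped Pointwise in
theorem tensorSub_mul_le {P Q P' Q' : Submodule k A} (hP : HomSpanned 𝒜 P)
    (hQ : HomSpanned 𝒜 Q) (hP' : HomSpanned 𝒜 P') (hQ' : HomSpanned 𝒜 Q') :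
    tensorSub 𝒜 P Q * tensorSub 𝒜 P' Q' ≤ tensorSub 𝒜 (P * P') (Q * Q') := by
  obtain ⟨s, hs, rfl⟩ := hP
  obtain ⟨t, ht, rfl⟩ := hQ
  obtain ⟨s', hs', rfl⟩ := hP'
  obtain ⟨t', ht', rfl⟩ := hQ'
  rw [tensorSub, tensorSub, Submodule.map₂_span_span, Submodule.map₂_span_span,
    Submodule.span_mul_span, Submodule.span_le]
  rintro _ ⟨_, ⟨a, ha, b, hb, rfl⟩, _, ⟨c, hc, d, hd, rfl⟩, rfl⟩
  obtain ⟨i, hi⟩ := ht hb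
  obtain ⟨j, hj⟩ := hs' hc
  have := GradedTensorProduct.tmul_coe_mul_coe_tmul 𝒜 𝒜 a (⟨b, hi⟩ : 𝒜 i) (⟨c, hj⟩ : 𝒜 j) d
  have h2 : GradedTensorProduct.tmul k (a * c) (b * d) ∈ tensorSub 𝒜
      (Submodule.span k s * Submodule.span k s') (Submodule.span k t * Submodule.span k t') :=
    Submodule.apply_mem_map₂ _
      (Submodule.mul_mem_mul (Submodule.subset_span ha) (Submodule.subset_span hc))
      (Submodule.mul_mem_mul (Submodule.subset_span hb) (Submodule.subset_span hd))
  have h3 : (-1 : ℤˣ) ^ (i * j) • (GradedTensorProduct.tmul k (a * c) (b * d) :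
      GradedTensorProduct k 𝒜 𝒜) ∈ tensorSub 𝒜
      (Submodule.span k s * Submodule.span k s') (Submodule.span k t * Submodule.span k t') := by
    rw [Units.smul_def]
    exact zsmul_mem h2 _
  rw [← this] at h3
  exact h3

variable [Coalgebra k A] [IsSuperBialgebra 𝒜]

theorem homSpanned_augIdeal : HomSpanned 𝒜 (augIdeal k A) := by
  apply homSpanned_of_forall
  intro a ha i
  have h1 : Coalgebra.counit (R := k) (DirectSum.decompose 𝒜 a 1 : A) = 0 :=
    IsSuperBialgebra.counit_odd (𝒜 := 𝒜) _ (DirectSum.decompose 𝒜 a 1).2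
  fin_cases i
  · rw [mem_augIdeal] at ha ⊢
    rw [eq_even_add_odd 𝒜 a, map_add, h1, add_zero] at ha
    exact ha
  · exact h1

theorem top_mul_augIdeal_le
    (𝒜 : ZMod 2 → Submodule k A) [GradedAlgebra 𝒜] [IsSuperBialgebra 𝒜] : ⊤ * augIdeal k A ≤ augIdeal k A := by
  rw [Submodule.mul_le]
  intro a _ b hb
  rw [mem_augIdeal] at hb ⊢
  rw [IsSuperBialgebra.counit_mul (𝒜 := 𝒜), hb, mul_zero]

theorem augIdeal_mul_top_le
    (𝒜 : ZMod 2 → Submodule k A) [GradedAlgebra 𝒜] [IsSuperBialgebra 𝒜] : augIdeal k A * ⊤ ≤ augIdeal k A := by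
  rw [Submodule.mul_le]
  intro a ha b _
  rw [mem_augIdeal] at ha ⊢
  rw [IsSuperBialgebra.counit_mul (𝒜 := 𝒜), ha, zero_mul]

theorem top_mul_augIdeal_pow_le
    (𝒜 : ZMod 2 → Submodule k A) [GradedAlgebra 𝒜] [IsSuperBialgebra 𝒜] {n : ℕ} (hn : 0 < n) :
    ⊤ * augIdeal k A ^ n ≤ augIdeal k A ^ n := by
  obtain ⟨n, rfl⟩ := Nat.exists_eq_succ_of_ne_zero hn.ne'
  rw [pow_succ', ← mul_assoc]
  exact mul_le_mul_left (top_mul_augIdeal_le 𝒜) _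

theorem augIdeal_pow_antitone
    (𝒜 : ZMod 2 → Submodule k A) [GradedAlgebra 𝒜] [IsSuperBialgebra 𝒜] {m n : ℕ} (hm : 0 < m) (h : m ≤ n) :
    augIdeal k A ^ n ≤ augIdeal k A ^ m := by
  obtain ⟨d, rfl⟩ := Nat.exists_eq_add_of_le h
  rw [add_comm, pow_add]
  exact (mul_le_mul_left le_top _).trans (top_mul_augIdeal_pow_le 𝒜 hm)

theorem homSpanned_top_mul_pow (n : ℕ) : HomSpanned 𝒜 (⊤ * augIdeal k A ^ n) := by
  induction n with
  | zero => rw [pow_zero, mul_one]; exact homSpanned_top 𝒜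
  | succ n ih => rw [pow_succ, ← mul_assoc]; exact ih.mul 𝒜 (homSpanned_augIdeal 𝒜)

theorem comul_mem_of_mem_augIdeal {a : A} (ha : a ∈ augIdeal k A) :
    GradedTensorProduct.of k 𝒜 𝒜 (Coalgebra.comul (R := k) a) ∈
      tensorSub 𝒜 (augIdeal k A) ⊤ ⊔ tensorSub 𝒜 ⊤ (augIdeal k A) := by
  have h : ∀ t : A ⊗[k] A, GradedTensorProduct.of k 𝒜 𝒜
      (t - 1 ⊗ₜ TensorProduct.lid k A (Coalgebra.counit.rTensor A t)) ∈
        tensorSub 𝒜 (augIdeal k A) ⊤ := by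
    intro t
    induction t with
    | zero => simp
    | add x y hx hy =>
      have := add_mem hx hy
      rw [← map_add] at this
      convert this using 2
      simp only [map_add, TensorProduct.tmul_add]
      abel
    | tmul b c =>
      have e : b ⊗ₜ[k] c - 1 ⊗ₜ TensorProduct.lid k A (Coalgebra.counit.rTensor A (b ⊗ₜ[k] c)) =
          (b - algebraMap k A (Coalgebra.counit (R := k) b)) ⊗ₜ[k] c := by
        rw [LinearMap.rTensor_tmul, TensorProduct.lid_tmul, TensorProduct.sub_tmul,
          Algebra.algebraMap_eq_smul_one, TensorProduct.smul_tmul]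
      rw [e]
      refine Submodule.apply_mem_map₂ _ (?_ : _ ∈ augIdeal k A) (Submodule.mem_top (x := c))
      rw [mem_augIdeal, map_sub, Algebra.algebraMap_eq_smul_one, map_smul,
        IsSuperBialgebra.counit_one (𝒜 := 𝒜), smul_eq_mul, mul_one, sub_self]
  have h1 := h (Coalgebra.comul (R := k) a)
  rw [Coalgebra.rTensor_counit_comul, TensorProduct.lid_tmul, one_smul] at h1
  have h2 : GradedTensorProduct.of k 𝒜 𝒜 (1 ⊗ₜ[k] a) ∈ tensorSub 𝒜 ⊤ (augIdeal k A) :=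
    Submodule.apply_mem_map₂ _ (Submodule.mem_top (x := (1 : A))) ha
  have h3 := Submodule.add_mem_sup h1 h2
  rwa [← map_add, sub_add_cancel] at h3

theorem comul_mem_of_mem_pow {n : ℕ} {a : A} (ha : a ∈ augIdeal k A ^ n) :
    GradedTensorProduct.of k 𝒜 𝒜 (Coalgebra.comul (R := k) a) ∈
      ⨆ (p : ℕ × ℕ) (_ : p.1 + p.2 = n),
        tensorSub 𝒜 (⊤ * augIdeal k A ^ p.1) (⊤ * augIdeal k A ^ p.2) := by
  induction n generalizing a with
  | zero =>
    refine Submodule.mem_iSup_of_mem (0, 0) (Submodule.mem_iSup_of_mem rfl ?_)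
    rw [pow_zero, mul_one]
    have h : ∀ t : A ⊗[k] A, GradedTensorProduct.of k 𝒜 𝒜 t ∈ tensorSub 𝒜 ⊤ ⊤ := by
      intro t
      induction t with
      | zero => simp
      | add x y hx hy => rw [map_add]; exact add_mem hx hy
      | tmul b c => exact Submodule.apply_mem_map₂ _ Submodule.mem_top Submodule.mem_top
    exact h _
  | succ n ih =>
    rw [pow_succ'] at ha
    induction ha using Submodule.mul_induction_on' with
    | add x _ y _ hx hy => rw [map_add, map_add]; exact add_mem hx hy
    | mem_mul_mem u hu v hv =>
      rw [IsSuperBialgebra.comul_mul (𝒜 := 𝒜)]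
      have h1 := Submodule.mul_mem_mul (comul_mem_of_mem_augIdeal 𝒜 hu) (ih hv)
      revert h1
      generalize GradedTensorProduct.of k 𝒜 𝒜 (Coalgebra.comul (R := k) u) *
        GradedTensorProduct.of k 𝒜 𝒜 (Coalgebra.comul (R := k) v) = w
      revert w
      rw [← SetLike.le_def]
      simp only [Submodule.sup_mul, Submodule.mul_iSup, sup_le_iff, iSup_le_iff]
      have hJ : ∀ i, augIdeal k A * (⊤ * augIdeal k A ^ i) ≤ ⊤ * augIdeal k A ^ (i + 1) := by
        intro i
        rw [← mul_assoc, pow_succ', ← mul_assoc]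
        refine mul_le_mul_left ((augIdeal_mul_top_le 𝒜).trans ?_) _
        intro x hx
        rw [← one_mul x]
        exact Submodule.mul_mem_mul Submodule.mem_top hx
      have hT : ∀ i, ⊤ * (⊤ * augIdeal k A ^ i) ≤ ⊤ * augIdeal k A ^ i := by
        intro i
        rw [← mul_assoc]
        exact mul_le_mul_left le_top _
      intro p hp
      constructor
      · refine (tensorSub_mul_le 𝒜 (homSpanned_augIdeal 𝒜) (homSpanned_top 𝒜)
          (homSpanned_top_mul_pow 𝒜 _) (homSpanned_top_mul_pow 𝒜 _)).trans ?_
        refine le_iSup_of_le (p.1 + 1, p.2) (le_iSup_of_le (by simp only; omega) ?_)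
        exact Submodule.map₂_le_map₂ (hJ _) (hT _)
      · refine (tensorSub_mul_le 𝒜 (homSpanned_top 𝒜) (homSpanned_augIdeal 𝒜)
          (homSpanned_top_mul_pow 𝒜 _) (homSpanned_top_mul_pow 𝒜 _)).trans ?_
        refine le_iSup_of_le (p.1, p.2 + 1) (le_iSup_of_le (by simp only; omega) ?_)
        exact Submodule.map₂_le_map₂ (hT _) (hJ _)

theorem conv_apply_eq_zero
    (𝒜 : ZMod 2 → Submodule k A) [GradedAlgebra 𝒜] [IsSuperBialgebra 𝒜] {m n : ℕ} (hm : 0 < m) (hn : 0 < n) {f g : A →ₗ[k] k}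
    (hf : ∀ a ∈ augIdeal k A ^ m, f a = 0) (hg : ∀ a ∈ augIdeal k A ^ n, g a = 0) {a : A}
    (ha : a ∈ augIdeal k A ^ (m + n)) :
    LinearMap.mul' k k (TensorProduct.map f g (Coalgebra.comul (R := k) a)) = 0 := by
  let Φ : GradedTensorProduct k 𝒜 𝒜 →ₗ[k] k :=
    (LinearMap.mul' k k ∘ₗ TensorProduct.map f g) ∘ₗ
      (GradedTensorProduct.of k 𝒜 𝒜).symm.toLinearMap
  have h := comul_mem_of_mem_pow 𝒜 ha
  have hle : (⨆ (p : ℕ × ℕ) (_ : p.1 + p.2 = m + n),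
        tensorSub 𝒜 (⊤ * augIdeal k A ^ p.1) (⊤ * augIdeal k A ^ p.2)) ≤ LinearMap.ker Φ := by
    refine iSup_le fun p => iSup_le fun hp => ?_
    rw [tensorSub, Submodule.map₂_le]
    intro x hx y hy
    have e : Φ (((TensorProduct.mk k A A).compr₂
        (GradedTensorProduct.of k 𝒜 𝒜).toLinearMap) x y) = f x * g y := rfl
    rw [LinearMap.mem_ker, e]
    by_cases hpm : m ≤ p.1
    · rw [hf x (augIdeal_pow_antitone 𝒜 hm hpm
        (top_mul_augIdeal_pow_le 𝒜 (hm.trans_le hpm) hx)), zero_mul]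
    · have hpn : n ≤ p.2 := by omega
      rw [hg y (augIdeal_pow_antitone 𝒜 hn hpn
        (top_mul_augIdeal_pow_le 𝒜 (hn.trans_le hpn) hy)), mul_zero]
  exact hle h

/-- The super hyperalgebra `hy(G)` of `G = SSp A`: the linear forms on `A` which vanish on some
power `(A⁺)ⁿ`, `n > 0`, of the augmentation ideal. It is a subalgebra of the dual algebra of the
coalgebra `A`, whose product is the convolution `(f * g)(a) = ∑ f a₍₁₎ * g a₍₂₎`. -/
def hy : Subalgebra k (WithConv (A →ₗ[k] k)) where
  carrier := {f | ∃ n : ℕ, 0 < n ∧ ∀ a ∈ augIdeal k A ^ n, f a = 0}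
  mul_mem' := by
    rintro f g ⟨m, hm, hf⟩ ⟨n, hn, hg⟩
    exact ⟨m + n, by omega, fun a ha => conv_apply_eq_zero 𝒜 hm hn hf hg ha⟩
  add_mem' := by
    rintro f g ⟨m, hm, hf⟩ ⟨n, hn, hg⟩
    refine ⟨m + n, by omega, fun a ha => ?_⟩
    have h1 := hf a (augIdeal_pow_antitone 𝒜 hm (by omega) ha)
    have h2 := hg a (augIdeal_pow_antitone 𝒜 hn (by omega) ha)
    change f a + g a = 0
    rw [h1, h2, add_zero]
  algebraMap_mem' := by
    intro c
    refine ⟨1, one_pos, fun a ha => ?_⟩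
    rw [pow_one, mem_augIdeal] at ha
    rw [LinearMap.convAlgebraMap_apply, ha, map_zero, smul_zero]

theorem mem_hy_iff (f : WithConv (A →ₗ[k] k)) :
    f ∈ hy 𝒜 ↔ ∃ n : ℕ, 0 < n ∧ ∀ a ∈ augIdeal k A ^ n, f a = 0 := Iff.rfl

theorem hy_mul_apply (u v : hy 𝒜) (a : A) :
    (u * v).1 a = LinearMap.mul' k k
      (TensorProduct.map u.1.ofConv v.1.ofConv (Coalgebra.comul (R := k) a)) := rfl

/-- The value at `a ∈ A` of the elements of `hy(G)`. -/
def evalHy (a : A) : Module.Dual k (hy 𝒜) where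
  toFun u := u.1 a
  map_add' _ _ := rfl
  map_smul' _ _ := rfl

@[simp] theorem evalHy_apply (a : A) (u : hy 𝒜) : evalHy 𝒜 a u = u.1 a := rfl

theorem evalHy_mem (a : A) : evalHy 𝒜 a ∈ FiniteDual k (hy 𝒜) := by
  -- `⟨h * u * h', a⟩` only depends on the values of `u` at finitely many elements
  obtain ⟨s, hs⟩ : ∃ s : Finset A, ∀ u : hy 𝒜, (∀ y ∈ s, u.1 y = 0) →
      ∀ h h' : hy 𝒜, (h * u * h').1 a = 0 := by
    let R := Coalgebra.Repr.arbitrary k a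
    let R' := fun x : A => Coalgebra.Repr.arbitrary k x
    classical
    refine ⟨R.index.biUnion fun i => (R' (R.left i)).index.image (R' (R.left i)).right, ?_⟩
    intro u hu h h'
    have e := R.convMul_apply (h * u).1 h'.1
    refine e.trans (Finset.sum_eq_zero fun i hi => ?_)
    have e' : (h * u).1 (R.left i) = 0 := by
      refine ((R' (R.left i)).convMul_apply h.1 u.1).trans (Finset.sum_eq_zero fun j hj => ?_)
      rw [hu _ (Finset.mem_biUnion.2 ⟨i, hi, Finset.mem_image_of_mem _ hj⟩), mul_zero]
    rw [e', zero_mul]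
  exact mem_finiteDual_of_forall (evalHy 𝒜 a)
    (LinearMap.pi fun y : s => evalHy 𝒜 y.1 : hy 𝒜 →ₗ[k] (s → k))
    fun u hu => hs u fun y hy => congrFun hu ⟨y, hy⟩

/-- The dual coalgebra `hy(G)°`. -/
abbrev HyDual : Type _ := FiniteDual k (hy 𝒜)

/-- The natural map `O(G) → hy(G)°` induced by the canonical pairing `hy(G) × O(G) → k`. -/
def toHyDual : A →ₗc[k] HyDual 𝒜 where
  toFun a := ⟨evalHy 𝒜 a, evalHy_mem 𝒜 a⟩
  map_add' a b := by
    ext u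
    exact map_add u.1.ofConv a b
  map_smul' c a := by
    ext u
    exact map_smul u.1.ofConv c a
  counit_comp := by
    ext a
    rfl
  map_comp_comul := by
    ext1 a
    apply FiniteDual.pair_injective
    ext u v
    have h : ∀ (r : A →ₗ[k] HyDual 𝒜) (_ : ∀ a (u : hy 𝒜), (r a).1 u = u.1 a) (t : A ⊗[k] A),
        FiniteDual.pair k (hy 𝒜) (TensorProduct.map r r t) (u ⊗ₜ v) =
          LinearMap.mul' k k (TensorProduct.map u.1.ofConv v.1.ofConv t) := by
      intro r hr t
      induction t with
      | zero => simp
      | add a b ha hb => simp [ha, hb]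
      | tmul b c => simp [hr]
    simp only [LinearMap.comp_apply, TensorProduct.AlgebraTensorModule.curry_apply,
      LinearMap.restrictScalars_self, TensorProduct.curry_apply]
    rw [h _ (fun _ _ => rfl), FiniteDual.pair_comul_tmul]
    rfl

@[simp] theorem toHyDual_apply (a : A) (u : hy 𝒜) : (toHyDual 𝒜 a).1 u = u.1 a := rfl

end Hyperalgebra

/-! ### The associated algebraic group `G_ev` -/

section Even

variable (𝒜 : ZMod 2 → Submodule k A)

/-- The ideal `(A₁)` generated by the odd elements. -/
def oddIdeal : Ideal A := Ideal.span (𝒜 1 : Set A)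

theorem odd_mem_oddIdeal {a : A} (ha : a ∈ 𝒜 1) : a ∈ oddIdeal 𝒜 := Ideal.subset_span ha

variable [GradedAlgebra 𝒜] [SuperCommutative 𝒜]

instance : (oddIdeal 𝒜).IsTwoSided := by
  constructor
  intro a b ha
  induction ha using Submodule.span_induction with
  | zero => rw [zero_mul]; exact zero_mem _
  | add x y _ _ hx hy => rw [add_mul]; exact add_mem hx hy
  | smul c x _ hx => rw [smul_eq_mul, mul_assoc]; exact Ideal.mul_mem_left _ _ hx
  | mem x hx =>
    rw [eq_even_add_odd 𝒜 b, mul_add,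
      ← SuperCommutative.even_comm (𝒜 := 𝒜) _ (DirectSum.decompose 𝒜 b 0).2,
      SuperCommutative.odd_anticomm (𝒜 := 𝒜) x hx _ (DirectSum.decompose 𝒜 b 1).2]
    exact add_mem (Ideal.mul_mem_left _ _ (odd_mem_oddIdeal 𝒜 hx))
      (neg_mem (Ideal.mul_mem_left _ _ (odd_mem_oddIdeal 𝒜 hx)))

/-- The algebra `O(G_ev) = A / (A₁)`. -/
abbrev EvQuot : Type _ := A ⧸ oddIdeal 𝒜

/-- The quotient map `A → A / (A₁)`. -/
def evMk : A →ₐ[k] EvQuot 𝒜 := Ideal.Quotient.mkₐ k (oddIdeal 𝒜)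

theorem evMk_odd {a : A} (ha : a ∈ 𝒜 1) : evMk 𝒜 a = 0 :=
  Ideal.Quotient.eq_zero_iff_mem.2 (odd_mem_oddIdeal 𝒜 ha)

theorem evMk_surjective : Function.Surjective (evMk 𝒜) := Ideal.Quotient.mk_surjective

theorem evMk_mul_comm (a b : A) : evMk 𝒜 a * evMk 𝒜 b = evMk 𝒜 b * evMk 𝒜 a := by
  have h : evMk 𝒜 a = evMk 𝒜 (DirectSum.decompose 𝒜 a 0 : A) := by
    conv_lhs => rw [eq_even_add_odd 𝒜 a]
    rw [map_add, evMk_odd 𝒜 (DirectSum.decompose 𝒜 a 1).2, add_zero]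
  rw [h, ← map_mul, ← map_mul,
    SuperCommutative.even_comm (𝒜 := 𝒜) _ (DirectSum.decompose 𝒜 a 0).2]

instance : CommRing (EvQuot 𝒜) where
  __ := (inferInstance : Ring (A ⧸ oddIdeal 𝒜))
  mul_comm x y := by
    obtain ⟨a, rfl⟩ := evMk_surjective 𝒜 x
    obtain ⟨b, rfl⟩ := evMk_surjective 𝒜 y
    exact evMk_mul_comm 𝒜 a b

/-- The algebra map `A ⊗ A → A / (A₁) ⊗ A / (A₁)`. -/
def evTensor : GradedTensorProduct k 𝒜 𝒜 →ₐ[k] EvQuot 𝒜 ⊗[k] EvQuot 𝒜 :=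
  GradedTensorProduct.lift 𝒜 𝒜
    (Algebra.TensorProduct.includeLeft.comp (evMk 𝒜))
    (Algebra.TensorProduct.includeRight.comp (evMk 𝒜)) (by
      intro i j a b
      rw [AlgHom.comp_apply, AlgHom.comp_apply, Algebra.TensorProduct.includeLeft_apply,
        Algebra.TensorProduct.includeRight_apply, Algebra.TensorProduct.tmul_mul_tmul,
        Algebra.TensorProduct.tmul_mul_tmul, one_mul, mul_one, one_mul, mul_one]
      fin_cases i
      · change _ = (-1 : ℤˣ) ^ (j * 0) • _
        rw [mul_zero, uzpow_zero, one_smul]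
      · rw [evMk_odd 𝒜 a.2, TensorProduct.zero_tmul, smul_zero])

@[simp] theorem evTensor_of (t : A ⊗[k] A) :
    evTensor 𝒜 (GradedTensorProduct.of k 𝒜 𝒜 t) =
      TensorProduct.map (evMk 𝒜).toLinearMap (evMk 𝒜).toLinearMap t := by
  induction t with
  | zero => simp
  | add x y hx hy => rw [map_add, map_add, hx, hy, map_add]
  | tmul a b =>
    refine (GradedTensorProduct.lift_tmul ..).trans ?_
    simp

variable [Coalgebra k A] [IsSuperBialgebra 𝒜]

/-- The coproduct of `O(G)` followed by the projection to `O(G_ev) ⊗ O(G_ev)`. -/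
def evComulAux : A →ₐ[k] EvQuot 𝒜 ⊗[k] EvQuot 𝒜 :=
  AlgHom.ofLinearMap
    (TensorProduct.map (evMk 𝒜).toLinearMap (evMk 𝒜).toLinearMap ∘ₗ Coalgebra.comul)
    (by
      rw [LinearMap.comp_apply, IsSuperBialgebra.comul_one (𝒜 := 𝒜), TensorProduct.map_tmul]
      simp [Algebra.TensorProduct.one_def])
    (by
      intro a b
      simp only [LinearMap.comp_apply]
      rw [← evTensor_of, IsSuperBialgebra.comul_mul (𝒜 := 𝒜), map_mul, evTensor_of, evTensor_of])

theorem evComulAux_odd {a : A} (ha : a ∈ 𝒜 1) : evComulAux 𝒜 a = 0 := by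
  have h := IsSuperBialgebra.comul_degree (𝒜 := 𝒜) 1 a ha
  have hle : tensorDegree 𝒜 1 ≤
      LinearMap.ker (TensorProduct.map (evMk 𝒜).toLinearMap (evMk 𝒜).toLinearMap) := by
    refine iSup_le fun j => ?_
    rintro _ ⟨t, rfl⟩
    rw [LinearMap.mem_ker]
    induction t with
    | zero => simp
    | add x y hx hy => rw [map_add, map_add, hx, hy, add_zero]
    | tmul b c =>
      rw [TensorProduct.map_tmul, TensorProduct.map_tmul]
      fin_cases j
      · have hc : (c : A) ∈ 𝒜 1 := c.2
        have : (evMk 𝒜).toLinearMap ((𝒜 _).subtype c) = 0 := evMk_odd 𝒜 hc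
        rw [this, TensorProduct.tmul_zero]
      · have : (evMk 𝒜).toLinearMap ((𝒜 _).subtype b) = 0 := evMk_odd 𝒜 b.2
        rw [this, TensorProduct.zero_tmul]
  exact hle h

/-- The coproduct of `O(G_ev)`, induced by that of `O(G)`. -/
def evComul : EvQuot 𝒜 →ₐ[k] EvQuot 𝒜 ⊗[k] EvQuot 𝒜 :=
  Ideal.Quotient.liftₐ (oddIdeal 𝒜) (evComulAux 𝒜) (by
    have : oddIdeal 𝒜 ≤ RingHom.ker (evComulAux 𝒜) :=
      Ideal.span_le.2 fun a ha => evComulAux_odd 𝒜 ha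
    exact fun a ha => this ha)

theorem evComul_evMk (a : A) : evComul 𝒜 (evMk 𝒜 a) =
    TensorProduct.map (evMk 𝒜).toLinearMap (evMk 𝒜).toLinearMap (Coalgebra.comul (R := k) a) := rfl

/-- The counit of `O(G_ev)`, induced by that of `O(G)`. -/
def evCounit : EvQuot 𝒜 →ₐ[k] k :=
  Ideal.Quotient.liftₐ (oddIdeal 𝒜)
    (AlgHom.ofLinearMap Coalgebra.counit (IsSuperBialgebra.counit_one (𝒜 := 𝒜))
      (IsSuperBialgebra.counit_mul (𝒜 := 𝒜)) : A →ₐ[k] k) (by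
    intro a ha
    induction ha using Submodule.span_induction with
    | zero => exact map_zero _
    | add x y _ _ hx hy => rw [map_add, hx, hy, add_zero]
    | smul c x _ hx => rw [smul_eq_mul, map_mul, hx, mul_zero]
    | mem x hx => exact IsSuperBialgebra.counit_odd (𝒜 := 𝒜) x hx)

theorem evCounit_evMk (a : A) : evCounit 𝒜 (evMk 𝒜 a) = Coalgebra.counit (R := k) a := rfl

/-- The bialgebra structure on `O(G_ev) = A / (A₁)` for which `A → A / (A₁)` is a coalgebra map. -/
instance : Bialgebra k (EvQuot 𝒜) :=
  Bialgebra.ofAlgHom (evComul 𝒜) (evCounit 𝒜)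
    (by
      refine Ideal.Quotient.algHom_ext k (AlgHom.ext fun a => ?_)
      have h1 : ∀ t : A ⊗[k] A, Algebra.TensorProduct.assoc k k k _ _ _
          (Algebra.TensorProduct.map (evComul 𝒜) (.id k _)
            (TensorProduct.map (evMk 𝒜).toLinearMap (evMk 𝒜).toLinearMap t)) =
          TensorProduct.map (evMk 𝒜).toLinearMap
            (TensorProduct.map (evMk 𝒜).toLinearMap (evMk 𝒜).toLinearMap)
            (TensorProduct.assoc k A A A (Coalgebra.comul.rTensor A t)) := by
        intro t
        induction t with
        | zero => simp
        | add x y hx hy => simp only [map_add, hx, hy]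
        | tmul b c =>
          simp only [TensorProduct.map_tmul, AlgHom.toLinearMap_apply,
            Algebra.TensorProduct.map_tmul, evComul_evMk, AlgHom.id_apply, LinearMap.rTensor_tmul]
          induction Coalgebra.comul (R := k) b with
          | zero => simp
          | add x y hx hy => simp only [map_add, TensorProduct.add_tmul, hx, hy]
          | tmul b b' => simp
      have h2 : ∀ t : A ⊗[k] A,
          Algebra.TensorProduct.map (.id k _) (evComul 𝒜)
            (TensorProduct.map (evMk 𝒜).toLinearMap (evMk 𝒜).toLinearMap t) =
          TensorProduct.map (evMk 𝒜).toLinearMap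
            (TensorProduct.map (evMk 𝒜).toLinearMap (evMk 𝒜).toLinearMap)
            (Coalgebra.comul.lTensor A t) := by
        intro t
        induction t with
        | zero => simp
        | add x y hx hy => simp only [map_add, hx, hy]
        | tmul b c => simp [evComul_evMk]
      have h3 := (h1 (Coalgebra.comul (R := k) a)).trans
        ((congrArg _ (Coalgebra.coassoc_apply a)).trans (h2 (Coalgebra.comul (R := k) a)).symm)
      exact h3)
    (by
      refine Ideal.Quotient.algHom_ext k (AlgHom.ext fun a => ?_)
      have h1 : ∀ t : A ⊗[k] A, Algebra.TensorProduct.map (evCounit 𝒜) (.id k _)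
            (TensorProduct.map (evMk 𝒜).toLinearMap (evMk 𝒜).toLinearMap t) =
          (evMk 𝒜).toLinearMap.lTensor k (Coalgebra.counit.rTensor A t) := by
        intro t
        induction t with
        | zero => simp
        | add x y hx hy => simp only [map_add, hx, hy]
        | tmul b c => simp [evCounit_evMk]
      refine (h1 (Coalgebra.comul (R := k) a)).trans ?_
      rw [Coalgebra.rTensor_counit_comul]
      rfl)
    (by
      refine Ideal.Quotient.algHom_ext k (AlgHom.ext fun a => ?_)
      have h1 : ∀ t : A ⊗[k] A, Algebra.TensorProduct.map (.id k _) (evCounit 𝒜)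
            (TensorProduct.map (evMk 𝒜).toLinearMap (evMk 𝒜).toLinearMap t) =
          (evMk 𝒜).toLinearMap.rTensor k (Coalgebra.counit.lTensor A t) := by
        intro t
        induction t with
        | zero => simp
        | add x y hx hy => simp only [map_add, hx, hy]
        | tmul b c => simp [evCounit_evMk]
      refine (h1 (Coalgebra.comul (R := k) a)).trans ?_
      rw [Coalgebra.lTensor_counit_comul]
      rfl)

/-- The quotient map `O(G) → O(G_ev)` as a coalgebra map. -/
def evMkCoalgHom : A →ₗc[k] EvQuot 𝒜 where
  __ := (evMk 𝒜).toLinearMap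
  counit_comp := rfl
  map_comp_comul := rfl

/-- The super hyperalgebra `hy(G_ev)` of the purely even group `G_ev`. -/
abbrev hyEv : Subalgebra k (WithConv (EvQuot 𝒜 →ₗ[k] k)) := hy (evenGrading k (EvQuot 𝒜))

/-- The inclusion `hy(G_ev) ⊆ hy(G)`, dual to `O(G) → O(G_ev)`. -/
def hyIncl : hyEv 𝒜 →ₐ[k] hy 𝒜 :=
  AlgHom.ofLinearMap
  { toFun := fun u => ⟨WithConv.toConv (u.1.ofConv ∘ₗ (evMk 𝒜).toLinearMap), by
      obtain ⟨n, hn, hu⟩ := u.2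
      refine ⟨n, hn, fun a ha => hu _ ?_⟩
      have h1 : (augIdeal k A).map (evMk 𝒜).toLinearMap ≤ augIdeal k (EvQuot 𝒜) := by
        rintro _ ⟨b, hb, rfl⟩
        exact hb
      have h2 := Submodule.mem_map_of_mem (f := (evMk 𝒜).toLinearMap) ha
      rw [Submodule.map_pow] at h2
      exact pow_le_pow_left' h1 n h2⟩
    map_add' := fun _ _ => rfl
    map_smul' := fun _ _ => rfl } rfl (by
  intro u v
  apply Subtype.ext
  apply WithConv.ofConv_injective
  exact LinearMap.convMul_comp_coalgHom_distrib u.1 v.1 (evMkCoalgHom 𝒜))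

@[simp] theorem hyIncl_apply (u : hyEv 𝒜) (a : A) : (hyIncl 𝒜 u).1 a = u.1 (evMk 𝒜 a) := rfl

/-- The dual coalgebra `hy(G_ev)°`. -/
abbrev HyEvDual : Type _ := HyDual (evenGrading k (EvQuot 𝒜))

/-- The natural map `O(G_ev) → hy(G_ev)°`. -/
abbrev toHyEvDual : EvQuot 𝒜 →ₗc[k] HyEvDual 𝒜 := toHyDual (evenGrading k (EvQuot 𝒜))

/-- `hy(G)°` as a left `hy(G_ev)°`-comodule, along the restriction map `hy(G)° → hy(G_ev)°`. -/
def hyDualComodule : LeftComodule k (HyEvDual 𝒜) (HyDual 𝒜) :=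
  LeftComodule.ofCoalgHom (FiniteDual.map (hyIncl 𝒜))

end Even

/-! ### Connectedness -/

section Connected

variable (𝒜 : ZMod 2 → Submodule k A) [GradedAlgebra 𝒜] [SuperCommutative 𝒜]

/-- The even component `A₀`, as a commutative ring. -/
abbrev evenCommRing : CommRing (𝒜 0) where
  __ := (inferInstance : Ring (𝒜 0))
  mul_comm a b := Subtype.ext (SuperCommutative.even_comm (𝒜 := 𝒜) _ a.2 b)

/-- The super algebraic group `SSp A` is connected: `Spec A₀` is a connected topological space. -/
def IsConnectedGroup : Prop :=
  letI := evenCommRing 𝒜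
  ConnectedSpace (PrimeSpectrum (𝒜 0))

end Connected

end Super

end SuperGroup

end

/-!
Write `B = A / (A₁)`, `π : A → B`, `H = hy(G)`, `J = hy(G_ev)` and `ρ : A → B ⊗ A`,
`a ↦ ∑ π a₍₁₎ ⊗ a₍₂₎`.

*Injectivity of `B → J°`.* The kernel `K` of `B → J°` is a coideal, as the kernel of a coalgebra
map, and an ideal contained in all powers of `B⁺`. By Krull's theorem `r K = 0` for some `r` with
`ε r = 1`. For `a ∈ K` the element `∑ [a₍₁₎] ⊗ a₍₂₎` lies in `B / K ⊗ K` and is killed by `1 ⊗ r`;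
undoing the shear `b ⊗ a ↦ ∑ b a₍₁₎ ⊗ a₍₂₎` by means of the antipode and multiplying out gives
`a = ε r • a ∈ K²`. Hence `K` is generated by an idempotent, which is `0` because `Spec B`, like
`Spec A₀`, is connected (`toHyDual_injective_of_isIdempotentElem`).

*The filtration by powers of `I = (A₁)`.* As `A` is a finite module over the Noetherian ring `A₀`
and odd elements have square zero, `I` is nilpotent, and `W = Iⁿ / A⁺Iⁿ` is finite-dimensional. The
fundamental theorem of Hopf modules, applied to `Iⁿ / Iⁿ⁺¹`, says that `ρ` induces a `B`-linear
isomorphism `Iⁿ / Iⁿ⁺¹ ≅ B ⊗ W`. By the Artin–Rees lemma the linear forms on `W` extend to elements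
`w j` of `H`, so that this isomorphism is given by coordinates `coactSlice (w j)`, with
`(x * w j) a = x (coactSlice (w j) a)` for `x ∈ J`; dually, an element of `H` which vanishes on
`Iⁿ⁺¹` agrees on `Iⁿ` with some `∑ x j * w j`, `x j ∈ J` (`exists_layer`).

*Conclusion.* An element of `A` killed by `H` has vanishing coordinates in every layer, hence lies in
every `Iⁿ` and is zero. If `f` belongs to an `O(G_ev)`-subcomodule of `H°`, there is a map
`F : H → B` with `f (x * y) = x (F y)` for `x ∈ J`. If `f` agrees with the evaluation at `a` on the
elements of `H` vanishing on `Iⁿ`, adding to `a` the element of `Iⁿ` with the coordinates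
`F (w j) - coactSlice (w j) a` extends this to the elements vanishing on `Iⁿ⁺¹`
(`exists_eq_eval`).
-/

open scoped TensorProduct

noncomputable section

namespace SuperGroup

/-! ### The algebra `C ⊗ A` and its twists by convolution inverses -/

section Twist

open Coalgebra WithConv

variable {k : Type*} [Field k] {A : Type*} [Ring A] [Algebra k A]
  {C : Type*} [CommRing C] [Algebra k C]

section Coact

variable [Coalgebra k A]

/-- The map `A → C ⊗ A`, `a ↦ ∑ g a₍₁₎ ⊗ a₍₂₎`. -/
def leftCoact (g : A →ₗ[k] C) : A →ₗ[k] C ⊗[k] A := g.rTensor A ∘ₗ comul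

/-- The `C`-linear map `C ⊗ A → C ⊗ A`, `b ⊗ a ↦ ∑ b * g a₍₁₎ ⊗ a₍₂₎`. -/
def twist (g : A →ₗ[k] C) : C ⊗[k] A →ₗ[k] C ⊗[k] A :=
  TensorProduct.lift ((LinearMap.mul k (C ⊗[k] A)).compl₁₂
    (Algebra.TensorProduct.includeLeft : C →ₐ[k] C ⊗[k] A).toLinearMap (leftCoact g))

@[simp]
theorem twist_tmul (g : A →ₗ[k] C) (b : C) (a : A) :
    twist g (b ⊗ₜ a) = (b ⊗ₜ 1) * leftCoact g a := rfl

theorem twist_left_mul (g : A →ₗ[k] C) (b : C) (z : C ⊗[k] A) :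
    twist g ((b ⊗ₜ 1) * z) = (b ⊗ₜ 1) * twist g z := by
  induction z with
  | zero => simp
  | add x y hx hy => rw [mul_add, map_add, hx, hy, map_add, mul_add]
  | tmul c a =>
    rw [Algebra.TensorProduct.tmul_mul_tmul, one_mul, twist_tmul, twist_tmul, ← mul_assoc,
      Algebra.TensorProduct.tmul_mul_tmul, one_mul]

/-- Composition of twists corresponds to convolution. -/
theorem twist_leftCoact (g h : A →ₗ[k] C) (a : A) :
    twist g (leftCoact h a) = leftCoact (toConv h * toConv g).ofConv a := by
  let M : A ⊗[k] (A ⊗[k] A) →ₗ[k] C ⊗[k] A :=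
    (LinearMap.mul' k C ∘ₗ TensorProduct.map h g).rTensor A ∘ₗ
      (TensorProduct.assoc k A A A).symm.toLinearMap
  have h1 : ∀ t : A ⊗[k] A, twist g (h.rTensor A t) = M (comul.lTensor A t) := by
    intro t
    induction t with
    | zero => simp
    | add x y hx hy => simp only [map_add, hx, hy]
    | tmul x y =>
      rw [LinearMap.rTensor_tmul, twist_tmul, leftCoact, LinearMap.lTensor_tmul,
        LinearMap.comp_apply]
      induction comul (R := k) y with
      | zero => simp
      | add x y hx hy => rw [map_add, mul_add, hx, hy, TensorProduct.tmul_add, map_add]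
      | tmul y z => simp [M]
  have h2 : ∀ t : A ⊗[k] A, (toConv h * toConv g).ofConv.rTensor A t =
      M (TensorProduct.assoc k A A A (comul.rTensor A t)) := by
    intro t
    simp only [M, LinearMap.comp_apply, LinearEquiv.coe_coe, LinearEquiv.symm_apply_apply]
    rw [← LinearMap.comp_apply, ← LinearMap.rTensor_comp]
    rfl
  rw [leftCoact, leftCoact, LinearMap.comp_apply, LinearMap.comp_apply, h1, h2,
    Coalgebra.coassoc_apply]

theorem leftCoact_one (a : A) :
    leftCoact (1 : WithConv (A →ₗ[k] C)).ofConv a = 1 ⊗ₜ a := by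
  have h : ∀ t : A ⊗[k] A, (1 : WithConv (A →ₗ[k] C)).ofConv.rTensor A t =
      (Algebra.linearMap k C).rTensor A (counit.rTensor A t) := by
    intro t
    rw [← LinearMap.comp_apply, ← LinearMap.rTensor_comp]
    rfl
  rw [leftCoact, LinearMap.comp_apply, h, Coalgebra.rTensor_counit_comul]
  simp

/-- `S` is a convolution inverse of the algebra map `q : A → C`, and `a ↦ ∑ q a₍₁₎ ⊗ a₍₂₎` is an
algebra map to the usual tensor product `C ⊗ A`. The algebra `A` is not assumed to be a bialgebra, so
that super Hopf algebras are covered. -/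
structure IsTwistPair (q : A →ₐ[k] C) (S : A →ₗ[k] C) : Prop where
  conv_left : toConv S * toConv q.toLinearMap = 1
  conv_right : toConv q.toLinearMap * toConv S = 1
  coact_one : leftCoact q.toLinearMap (1 : A) = 1
  coact_mul : ∀ a b, leftCoact q.toLinearMap (a * b) =
    leftCoact q.toLinearMap a * leftCoact q.toLinearMap b

namespace IsTwistPair

variable {q : A →ₐ[k] C} {S : A →ₗ[k] C} (h : IsTwistPair q S)
include h

theorem twist_mul (z z' : C ⊗[k] A) :
    twist q.toLinearMap (z * z') = twist q.toLinearMap z * twist q.toLinearMap z' := by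
  have hc : ∀ (b : C) (z : C ⊗[k] A), z * (b ⊗ₜ 1) = (b ⊗ₜ 1) * z := by
    intro b z
    induction z with
    | zero => simp
    | add x y hx hy => rw [add_mul, mul_add, hx, hy]
    | tmul c a => simp [mul_comm]
  induction z with
  | zero => simp
  | add x y hx hy => rw [add_mul, map_add, hx, hy, map_add, add_mul]
  | tmul b a =>
    induction z' with
    | zero => simp
    | add x y hx hy => rw [mul_add, map_add, hx, hy, map_add, mul_add]
    | tmul b' a' =>
      rw [Algebra.TensorProduct.tmul_mul_tmul, twist_tmul, twist_tmul, twist_tmul, h.coact_mul,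
        mul_assoc (b ⊗ₜ 1) (leftCoact _ a), ← mul_assoc (leftCoact _ a) (b' ⊗ₜ 1), hc,
        mul_assoc (b' ⊗ₜ 1), ← mul_assoc (b ⊗ₜ 1) (b' ⊗ₜ 1),
        Algebra.TensorProduct.tmul_mul_tmul, one_mul]

theorem twist_twist (z : C ⊗[k] A) : twist q.toLinearMap (twist S z) = z := by
  induction z with
  | zero => simp
  | add x y hx hy => rw [map_add, map_add, hx, hy]
  | tmul b a =>
    rw [twist_tmul, twist_left_mul, twist_leftCoact, h.conv_left, leftCoact_one]
    simp

theorem twist_twist' (z : C ⊗[k] A) : twist S (twist q.toLinearMap z) = z := by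
  induction z with
  | zero => simp
  | add x y hx hy => rw [map_add, map_add, hx, hy]
  | tmul b a =>
    rw [twist_tmul, twist_left_mul, twist_leftCoact, h.conv_right, leftCoact_one]
    simp

theorem twist_antipode_mul (z z' : C ⊗[k] A) : twist S (z * z') = twist S z * twist S z' := by
  apply Function.LeftInverse.injective h.twist_twist'
  rw [h.twist_mul, h.twist_twist, h.twist_twist, h.twist_twist]

theorem twist_antipode_one : twist S (1 : C ⊗[k] A) = 1 := by
  apply Function.LeftInverse.injective h.twist_twist'
  rw [h.twist_twist, Algebra.TensorProduct.one_def, twist_tmul, h.coact_one,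
    Algebra.TensorProduct.one_def]
  simp

/-- The coaction `A → C ⊗ A`, `a ↦ ∑ q a₍₁₎ ⊗ a₍₂₎`, as an algebra map. -/
def coactHom : A →ₐ[k] C ⊗[k] A := AlgHom.ofLinearMap (leftCoact q.toLinearMap) h.coact_one h.coact_mul

/-- The algebra map `A → C ⊗ A`, `a ↦ ∑ S a₍₁₎ ⊗ a₍₂₎`. -/
def antipodeHom : A →ₐ[k] C ⊗[k] A :=
  AlgHom.ofLinearMap (leftCoact S)
    (by
      have := h.twist_antipode_one
      rwa [Algebra.TensorProduct.one_def, twist_tmul, ← Algebra.TensorProduct.one_def,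
        one_mul] at this)
    (fun a b => by
      have := h.twist_antipode_mul (1 ⊗ₜ a) (1 ⊗ₜ b)
      rwa [Algebra.TensorProduct.tmul_mul_tmul, one_mul, twist_tmul, twist_tmul, twist_tmul,
        ← Algebra.TensorProduct.one_def, one_mul, one_mul, one_mul] at this)

theorem coactHom_apply (a : A) : h.coactHom a = leftCoact q.toLinearMap a := rfl

theorem antipodeHom_apply (a : A) : h.antipodeHom a = leftCoact S a := rfl

theorem twist_coactHom (a : A) : twist S (h.coactHom a) = 1 ⊗ₜ a := by
  have := h.twist_twist' (1 ⊗ₜ a)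
  rwa [twist_tmul, ← Algebra.TensorProduct.one_def, one_mul] at this

end IsTwistPair

end Coact

section Contract

/-- For a linear map `s : C → A`, the map `C ⊗ A → A`, `c ⊗ a ↦ s c * a`. -/
def contract (s : C →ₗ[k] A) : C ⊗[k] A →ₗ[k] A :=
  TensorProduct.lift ((LinearMap.mul k A).comp s)

@[simp] theorem contract_tmul (s : C →ₗ[k] A) (c : C) (a : A) : contract s (c ⊗ₜ a) = s c * a := rfl

/-- The map `C ⊗ A → C`, `c ⊗ a ↦ c * q a`. -/
def mulMap (q : A →ₐ[k] C) : C ⊗[k] A →ₗ[k] C := LinearMap.mul' k C ∘ₗ q.toLinearMap.lTensor C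

@[simp] theorem mulMap_tmul (q : A →ₐ[k] C) (c : C) (a : A) : mulMap q (c ⊗ₜ a) = c * q a := rfl

/-- The subspace `C ⊗ P` of `C ⊗ A`. -/
def rightSub (C : Type*) [CommRing C] [Algebra k C] (P : Submodule k A) : Submodule k (C ⊗[k] A) :=
  Submodule.map₂ (TensorProduct.mk k C A) ⊤ P

theorem tmul_mem_rightSub {P : Submodule k A} (c : C) {a : A} (ha : a ∈ P) :
    c ⊗ₜ[k] a ∈ rightSub C P := Submodule.apply_mem_map₂ _ Submodule.mem_top ha

theorem rightSub_le {P : Submodule k A} {Q : Submodule k (C ⊗[k] A)}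
    (h : ∀ c : C, ∀ a ∈ P, c ⊗ₜ[k] a ∈ Q) : rightSub C P ≤ Q :=
  Submodule.map₂_le.2 fun c _ a ha => h c a ha

theorem contract_mem {s : C →ₗ[k] A} {P Q : Submodule k A} (h : ∀ a, ∀ p ∈ P, a * p ∈ Q)
    {z : C ⊗[k] A} (hz : z ∈ rightSub C P) : contract s z ∈ Q :=
  (rightSub_le (Q := Q.comap (contract s)) fun c p hp => h (s c) p hp) hz

theorem rightSub_mul_le (P Q : Submodule k A) :
    rightSub C P * rightSub C Q ≤ rightSub C (P * Q) := by
  rw [Submodule.mul_le]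
  intro x hx y hy
  refine rightSub_le (Q := (rightSub C (P * Q)).comap (LinearMap.mulRight k y)) (fun c p hp => ?_) hx
  refine rightSub_le (Q := (rightSub C (P * Q)).comap (LinearMap.mulLeft k (c ⊗ₜ[k] p)))
    (fun c' p' hp' => ?_) hy
  rw [Submodule.mem_comap, LinearMap.mulLeft_apply, Algebra.TensorProduct.tmul_mul_tmul]
  exact tmul_mem_rightSub (c * c') (Submodule.mul_mem_mul hp hp')

theorem rightSub_pow_le (P : Submodule k A) (n : ℕ) :
    rightSub C P ^ n ≤ rightSub C (P ^ n) := by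
  induction n with
  | zero =>
    rw [pow_zero, pow_zero, Submodule.one_le]
    exact tmul_mem_rightSub 1 ((Submodule.one_le (P := (1 : Submodule k A))).1 le_rfl)
  | succ n ih =>
    rw [pow_succ, pow_succ]
    exact (mul_le_mul_left ih _).trans (rightSub_mul_le _ _)

theorem rightSub_top : rightSub C (⊤ : Submodule k A) = ⊤ := by
  rw [eq_top_iff]
  intro z _
  induction z with
  | zero => exact zero_mem _
  | add x y hx hy => exact add_mem (hx trivial) (hy trivial)
  | tmul c a => exact tmul_mem_rightSub c Submodule.mem_top

/-- If `s` is a linear section of `q`, then `c ⊗ a ↦ s c * a` is multiplicative up to the kernel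
of `q`. -/
theorem contract_mul_sub_mem {q : A →ₐ[k] C} {s : C →ₗ[k] A} (hs : ∀ c, q (s c) = c)
    {P Q : Submodule k A} (hPQ : ∀ y, q y = 0 → ∀ p ∈ P, y * p ∈ Q) (z : C ⊗[k] A)
    {z' : C ⊗[k] A} (hz' : z' ∈ rightSub C P) :
    contract s (z * z') - s (mulMap q z) * contract s z' ∈ Q := by
  induction z with
  | zero => simp
  | add x y hx hy =>
    convert add_mem hx hy using 1
    simp only [add_mul, map_add]
    abel
  | tmul b c =>
    refine (rightSub_le (Q := Q.comap (contract s ∘ₗ LinearMap.mulLeft k (b ⊗ₜ c) -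
      LinearMap.mulLeft k (s (mulMap q (b ⊗ₜ[k] c))) ∘ₗ contract s)) fun b' p hp => ?_) hz'
    change contract s ((b ⊗ₜ c) * (b' ⊗ₜ p)) - s (b * q c) * (s b' * p) ∈ Q
    rw [Algebra.TensorProduct.tmul_mul_tmul, contract_tmul, ← mul_assoc, ← mul_assoc, ← sub_mul]
    apply hPQ _ _ _ hp
    simp only [map_sub, map_mul, hs]
    ring

/-- The identity `∑ S a₍₁₎ * q a₍₂₎ = ε a`. -/
theorem mulMap_leftCoact [Coalgebra k A] {q : A →ₐ[k] C} {S : A →ₗ[k] C} (h : IsTwistPair q S)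
    (a : A) : mulMap q (leftCoact S a) = algebraMap k C (Coalgebra.counit (R := k) a) := by
  have h1 : ∀ t : A ⊗[k] A, mulMap q (S.rTensor A t) =
      LinearMap.mul' k C (TensorProduct.map S q.toLinearMap t) := by
    intro t
    induction t with
    | zero => simp
    | add x y hx hy => simp only [map_add, hx, hy]
    | tmul x y => simp
  rw [leftCoact, LinearMap.comp_apply, h1]
  exact congrArg (fun f : WithConv (A →ₗ[k] C) => f a) h.conv_left

/-- For a linear form `w` on `A`, the map `C ⊗ A → C`, `c ⊗ a ↦ w a • c`. -/
def slice (C : Type*) [CommRing C] [Algebra k C] (w : A →ₗ[k] k) : C ⊗[k] A →ₗ[k] C :=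
  (TensorProduct.rid k C).toLinearMap ∘ₗ w.lTensor C

@[simp] theorem slice_tmul (w : A →ₗ[k] k) (c : C) (a : A) : slice C w (c ⊗ₜ a) = w a • c := rfl

/-- If `w (a * p) = e a * w p` for `p ∈ P`, then slicing elements of `C ⊗ P` along `w` turns the
multiplication by `z` into the multiplication by the slice of `z` along `e`. -/
theorem slice_mul {w e : A →ₗ[k] k} {P : Submodule k A}
    (h : ∀ a, ∀ p ∈ P, w (a * p) = e a * w p) (z : C ⊗[k] A) {z' : C ⊗[k] A}
    (hz' : z' ∈ rightSub C P) : slice C w (z * z') = slice C e z * slice C w z' := by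
  induction z with
  | zero => simp
  | add x y hx hy => rw [add_mul, map_add, hx, hy, map_add, add_mul]
  | tmul b c =>
    refine (rightSub_le (Q := LinearMap.eqLocus (slice C w ∘ₗ LinearMap.mulLeft k (b ⊗ₜ c))
      (LinearMap.mulLeft k (slice C e (b ⊗ₜ c)) ∘ₗ slice C w)) fun b' p hp => ?_) hz'
    change slice C w ((b ⊗ₜ c) * (b' ⊗ₜ p)) = slice C e (b ⊗ₜ c) * slice C w (b' ⊗ₜ p)
    rw [Algebra.TensorProduct.tmul_mul_tmul, slice_tmul, slice_tmul, slice_tmul, h c p hp,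
      smul_mul_smul_comm]

theorem slice_counit_leftCoact [Coalgebra k A] (g : A →ₗ[k] C) (a : A) :
    slice C (counit (R := k)) (leftCoact g a) = g a := by
  have h : ∀ t : A ⊗[k] A, (counit (R := k)).lTensor C (g.rTensor A t) =
      g.rTensor k ((counit (R := k)).lTensor A t) := by
    intro t
    induction t with
    | zero => simp
    | add x y hx hy => simp only [map_add, hx, hy]
    | tmul x y => simp
  rw [leftCoact, slice, LinearMap.comp_apply, LinearMap.comp_apply, h,
    Coalgebra.lTensor_counit_comul]
  simp

/-- The convolution product of `x ∘ q` and `w`, evaluated in two steps. -/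
theorem apply_slice_leftCoact [Coalgebra k A] (q : A →ₗ[k] C) (x : C →ₗ[k] k) (w : A →ₗ[k] k)
    (a : A) : x (slice C w (leftCoact q a)) = (toConv (x ∘ₗ q) * toConv w) a := by
  have h : ∀ t : A ⊗[k] A, x (slice C w (q.rTensor A t)) =
      LinearMap.mul' k k (TensorProduct.map (x ∘ₗ q) w t) := by
    intro t
    induction t with
    | zero => simp
    | add x y hx hy => simp only [map_add, hx, hy]
    | tmul x y => simp [mul_comm]
  exact h _

/-- If `S` is a convolution inverse of the algebra map `q`, then `S` is multiplicative. -/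
theorem IsTwistPair.antipode_mul [Coalgebra k A] {q : A →ₐ[k] C} {S : A →ₗ[k] C}
    (h : IsTwistPair q S) (hε : ∀ a b : A, counit (R := k) (a * b) =
      counit (R := k) a * counit (R := k) b) (a b : A) : S (a * b) = S a * S b := by
  rw [← slice_counit_leftCoact S, ← slice_counit_leftCoact S a, ← slice_counit_leftCoact S b,
    ← h.antipodeHom_apply, map_mul]
  exact slice_mul (P := ⊤) (fun a p _ => hε a p) _ (by rw [rightSub_top]; trivial)

end Contract

end Twist

/-! ### The Krull intersection for connected commutative Hopf algebras -/

section Krull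

open Coalgebra WithConv

variable {k : Type*} [Field k]

theorem toHyDual_eq_zero_iff {A : Type*} [Ring A] [Algebra k A] (𝒜 : ZMod 2 → Submodule k A)
    [GradedAlgebra 𝒜] [Coalgebra k A] [IsSuperBialgebra 𝒜] {a : A} :
    toHyDual 𝒜 a = 0 ↔ ∀ u ∈ hy 𝒜, u.ofConv a = 0 :=
  ⟨fun h u hu => DFunLike.congr_fun (congrArg Subtype.val h) (⟨u, hu⟩ : hy 𝒜),
    fun h => Subtype.ext (LinearMap.ext fun u => h u.1 u.2)⟩

/-- The linear forms in `hy(G)` separate the elements of `A` from every subspace which contains a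
power of the augmentation ideal. -/
theorem mem_of_toHyDual_eq_zero {A : Type*} [Ring A] [Algebra k A] (𝒜 : ZMod 2 → Submodule k A)
    [GradedAlgebra 𝒜] [Coalgebra k A] [IsSuperBialgebra 𝒜] {a : A} (ha : toHyDual 𝒜 a = 0)
    {n : ℕ} (hn : 0 < n) {P : Submodule k A} (hP : augIdeal k A ^ n ≤ P) : a ∈ P := by
  by_contra h
  obtain ⟨f, hf, hle⟩ := Submodule.exists_le_ker_of_notMem h
  exact hf ((toHyDual_eq_zero_iff 𝒜).1 ha (toConv f) ⟨n, hn, fun b hb => hle (hP hb)⟩)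

variable {B : Type*} [CommRing B] [Bialgebra k B]

theorem augIdeal_pow_le_ker_pow (n : ℕ) :
    augIdeal k B ^ n ≤ ((RingHom.ker (Bialgebra.counitAlgHom k B)) ^ n).restrictScalars k := by
  induction n with
  | zero => exact fun x _ => by rw [pow_zero, Ideal.one_eq_top]; trivial
  | succ n ih =>
    rw [pow_succ, pow_succ, Submodule.mul_le]
    exact fun x hx y hy => Ideal.mul_mem_mul (ih hx) hy

variable (k B) in
/-- The kernel of `B → hy(B)°`, as an ideal. -/
def hyKer : Ideal B where
  carrier := {a | ∀ u ∈ hy (evenGrading k B), u.ofConv a = 0}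
  zero_mem' u _ := map_zero u.ofConv
  add_mem' {a b} ha hb u hu := by rw [map_add, ha u hu, hb u hu, add_zero]
  smul_mem' c a ha u hu := by
    obtain ⟨n, hn, hu⟩ := hu
    exact ha (toConv (u.ofConv ∘ₗ LinearMap.mulLeft k c)) ⟨n, hn, fun b hb => hu _
      (top_mul_augIdeal_pow_le (evenGrading k B) hn
        (Submodule.mul_mem_mul Submodule.mem_top hb))⟩

theorem mem_hyKer {a : B} : a ∈ hyKer k B ↔ toHyDual (evenGrading k B) a = 0 :=
  (toHyDual_eq_zero_iff _).symm

theorem isTwistPair_quotient (I : Ideal B) {S : B →ₗ[k] B}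
    (h₁ : toConv S * toConv LinearMap.id = 1) (h₂ : toConv LinearMap.id * toConv S = 1) :
    IsTwistPair (Ideal.Quotient.mkₐ k I) ((Ideal.Quotient.mkₐ k I).toLinearMap ∘ₗ S) where
  conv_left := by
    apply ofConv_injective
    have := LinearMap.algHom_comp_convMul_distrib (Ideal.Quotient.mkₐ k I) (toConv S)
      (toConv LinearMap.id)
    rw [h₁] at this
    refine this.symm.trans ?_
    ext a
    simp
  conv_right := by
    apply ofConv_injective
    have := LinearMap.algHom_comp_convMul_distrib (Ideal.Quotient.mkₐ k I)
      (toConv LinearMap.id) (toConv S)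
    rw [h₂] at this
    refine this.symm.trans ?_
    ext a
    simp
  coact_one := by
    rw [leftCoact, LinearMap.comp_apply, Bialgebra.comul_one]
    exact map_one (Algebra.TensorProduct.map (Ideal.Quotient.mkₐ k I) (AlgHom.id k B))
  coact_mul a b := by
    rw [leftCoact, LinearMap.comp_apply, Bialgebra.comul_mul]
    exact map_mul (Algebra.TensorProduct.map (Ideal.Quotient.mkₐ k I) (AlgHom.id k B)) _ _

/-- A linear map which vanishes on the kernel of `q` factors through `q`; stated without the quotient
space, for an arbitrary surjection `q`. -/
theorem exists_comp_eq_of_surjective {V W U : Type*} [AddCommGroup V] [Module k V] [AddCommGroup W]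
    [Module k W] [AddCommGroup U] [Module k U] {q : V →ₗ[k] W} (hq : Function.Surjective q)
    {f : V →ₗ[k] U} (h : ∀ v, q v = 0 → f v = 0) : ∃ e : W →ₗ[k] U, e ∘ₗ q = f := by
  obtain ⟨s, hs⟩ := LinearMap.exists_rightInverse_of_surjective q (LinearMap.range_eq_top.2 hq)
  have hs' : ∀ w, q (s w) = w := LinearMap.congr_fun hs
  refine ⟨f ∘ₗ s, LinearMap.ext fun v => ?_⟩
  have := h (s (q v) - v) (by rw [map_sub, hs', sub_self])
  rw [map_sub, sub_eq_zero] at this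
  exact this

theorem exists_injective_comp_eq {V W U : Type*} [AddCommGroup V] [Module k V] [AddCommGroup W]
    [Module k W] [AddCommGroup U] [Module k U] {q : V →ₗ[k] W} (hq : Function.Surjective q)
    {f : V →ₗ[k] U} (h : ∀ v, q v = 0 ↔ f v = 0) :
    ∃ e : W →ₗ[k] U, Function.Injective e ∧ e ∘ₗ q = f := by
  obtain ⟨e, he⟩ := exists_comp_eq_of_surjective hq fun v => (h v).1
  refine ⟨e, (injective_iff_map_eq_zero _).2 fun w hw => ?_, he⟩
  obtain ⟨v, rfl⟩ := hq w
  exact (h v).2 ((LinearMap.congr_fun he v).symm.trans hw)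

/-- The kernel of a coalgebra map `f` is a coideal: if `q` has the same kernel as `f`, then
`∑ q a₍₁₎ ⊗ a₍₂₎` lies in `C ⊗ Ker q` for `a` in `Ker q`. -/
theorem leftCoact_mem_rightSub_ker {A : Type*} [Ring A] [Algebra k A] [Coalgebra k A]
    {C : Type*} [CommRing C] [Algebra k C] {D : Type*} [AddCommGroup D] [Module k D]
    [Coalgebra k D] {q : A →ₗ[k] C} (hq : Function.Surjective q) (f : A →ₗc[k] D)
    (h : ∀ a, q a = 0 ↔ f a = 0) {a : A} (ha : q a = 0) :
    leftCoact q a ∈ rightSub C (LinearMap.ker q) := by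
  obtain ⟨e, he, heq⟩ := exists_injective_comp_eq hq (f := f.toLinearMap) h
  have h0 : TensorProduct.map q q (comul (R := k) a) = 0 := by
    apply TensorProduct.map_injective_of_flat_flat e e he he
    rw [map_zero, ← LinearMap.comp_apply, ← TensorProduct.map_comp, heq]
    have := CoalgHomClass.map_comp_comul_apply f a
    refine this.trans ?_
    rw [(h a).1 ha, map_zero]
  have h1 : q.lTensor C (leftCoact q a) = 0 := by
    rw [leftCoact, LinearMap.comp_apply, ← LinearMap.comp_apply, LinearMap.lTensor_comp_rTensor]
    exact h0
  obtain ⟨t, ht⟩ := (lTensor_exact C (LinearMap.exact_subtype_ker_map q) hq _).1 h1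
  rw [← ht]
  clear ht
  induction t with
  | zero => rw [map_zero]; exact zero_mem _
  | add x y hx hy => rw [map_add]; exact add_mem hx hy
  | tmul c b => exact tmul_mem_rightSub c b.2

/-- If a Noetherian commutative Hopf algebra `B` has no non-trivial idempotents, then the linear
forms vanishing on a power of the augmentation ideal separate its elements. -/
theorem toHyDual_injective_of_isIdempotentElem [IsNoetherianRing B] {S : B →ₗ[k] B}
    (h₁ : toConv S * toConv LinearMap.id = 1) (h₂ : toConv LinearMap.id * toConv S = 1)
    (hB : ∀ e : B, IsIdempotentElem e → e = 0 ∨ e = 1) :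
    Function.Injective (toHyDual (evenGrading k B)) := by
  set K := hyKer k B with hK
  set m : Ideal B := RingHom.ker (Bialgebra.counitAlgHom k B) with hm
  -- `K` lies in all powers of `m`, so every `a ∈ K` is `r * a` for some `r ∈ m`
  have hKm : K ≤ m • K := by
    intro a ha
    have : a ∈ (⨅ i : ℕ, m ^ i • ⊤ : Ideal B) := by
      rw [Submodule.mem_iInf]
      intro i
      have hle : augIdeal k B ^ (i + 1) ≤ (m ^ i).restrictScalars k :=
        (augIdeal_pow_le_ker_pow (i + 1)).trans (Ideal.pow_le_pow_right i.le_succ)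
      rw [smul_eq_mul, Ideal.mul_top]
      exact mem_of_toHyDual_eq_zero _ (mem_hyKer.1 ha) i.succ_pos hle
    obtain ⟨r, hr⟩ := (Ideal.mem_iInf_smul_pow_eq_bot_iff m a).1 this
    rw [← hr]
    exact Submodule.smul_mem_smul r.2 ha
  obtain ⟨r, hr, hrK⟩ := Submodule.exists_sub_one_mem_and_smul_eq_zero_of_fg_of_le_smul m K
    (IsNoetherian.noetherian K) hKm
  have hrε : counit (R := k) r = 1 := by
    have : counit (R := k) (r - 1) = 0 := hr
    rw [map_sub, Bialgebra.counit_one, sub_eq_zero] at this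
    exact this
  have hp := isTwistPair_quotient K h₁ h₂
  obtain ⟨s, hs⟩ := LinearMap.exists_rightInverse_of_surjective
    (Ideal.Quotient.mkₐ k K).toLinearMap
    (LinearMap.range_eq_top.2 Ideal.Quotient.mk_surjective)
  have hs' : ∀ c, Ideal.Quotient.mkₐ k K (s c) = c := fun c => LinearMap.congr_fun hs c
  have hK2 : K ≤ K * K := by
    intro a ha
    -- `1 ⊗ r` kills the coaction of `a`; untwisting turns it into `∑ S r₍₁₎ ⊗ r₍₂₎`, which acts on
    -- `K / K²` as `ε r = 1`
    have h3 : ((1 : B ⧸ K) ⊗ₜ[k] r) * hp.coactHom a = 0 := by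
      have hqK : ∀ b, (Ideal.Quotient.mkₐ k K).toLinearMap b = 0 ↔
          toHyDual (evenGrading k B) b = 0 :=
        fun b => Ideal.Quotient.eq_zero_iff_mem.trans mem_hyKer
      have := leftCoact_mem_rightSub_ker (D := HyDual (evenGrading k B)) Ideal.Quotient.mk_surjective
        (toHyDual (evenGrading k B)) hqK ((hqK a).2 (mem_hyKer.1 ha))
      refine (rightSub_le (Q := LinearMap.ker (LinearMap.mulLeft k ((1 : B ⧸ K) ⊗ₜ[k] r)))
        (fun c b hb => ?_)) this
      rw [LinearMap.mem_ker, LinearMap.mulLeft_apply, Algebra.TensorProduct.tmul_mul_tmul,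
        ← smul_eq_mul r, hrK b (Ideal.Quotient.eq_zero_iff_mem.1 hb), TensorProduct.tmul_zero]
    have h4 := hp.twist_antipode_mul (1 ⊗ₜ r) (hp.coactHom a)
    rw [h3, map_zero, hp.twist_coactHom, twist_tmul, ← Algebra.TensorProduct.one_def, one_mul] at h4
    have h5 := contract_mul_sub_mem hs' (P := K.restrictScalars k)
      (Q := (K * K).restrictScalars k)
      (fun y hy p hp => Ideal.mul_mem_mul (Ideal.Quotient.eq_zero_iff_mem.1 hy) hp)
      (leftCoact ((Ideal.Quotient.mkₐ k K).toLinearMap ∘ₗ S) r)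
      (tmul_mem_rightSub (1 : B ⧸ K) ha)
    rw [← h4, map_zero, zero_sub, mulMap_leftCoact hp, hrε, map_one, contract_tmul] at h5
    have h6 : s 1 * (s 1 * a) ∈ K * K := by
      have := neg_mem h5
      rwa [neg_neg] at this
    have h7 : ∀ b ∈ K, b - s 1 * b ∈ K * K := by
      intro b hb
      rw [← one_sub_mul]
      refine Ideal.mul_mem_mul ?_ hb
      refine Ideal.Quotient.eq_zero_iff_mem.1 (?_ : Ideal.Quotient.mkₐ k K _ = 0)
      rw [map_sub, hs', map_one, sub_self]
    have h8 := add_mem (add_mem (h7 a ha) (h7 _ (K.mul_mem_left (s 1) ha))) h6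
    simpa using h8
  obtain ⟨e, he, heK⟩ := (Ideal.isIdempotentElem_iff_of_fg K (IsNoetherian.noetherian K)).1
    (le_antisymm Ideal.mul_le_left hK2)
  rw [injective_iff_map_eq_zero]
  intro a ha
  have haK : a ∈ K := mem_hyKer.2 ha
  rcases hB e he with rfl | rfl
  · rw [heK] at haK
    simpa using haK
  · exfalso
    have h1 : (1 : B) ∈ hyKer k B := by
      rw [← hK, heK]; simp
    have : (1 : B) ∈ augIdeal k B :=
      mem_of_toHyDual_eq_zero _ (mem_hyKer.1 h1) one_pos (by rw [pow_one])
    rw [mem_augIdeal, Bialgebra.counit_one] at this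
    exact one_ne_zero this

end Krull

/-! ### Finiteness of super-commutative algebras, and the powers of `(A₁)` -/

section OddPowers

variable {k : Type*} [Field k] {A : Type*} [Ring A] [Algebra k A]
  (𝒜 : ZMod 2 → Submodule k A)

/-- The `n`-th power of the ideal `(A₁)`, as a subspace of `A`; it is `A` for `n = 0`. -/
def oddPow (n : ℕ) : Submodule k A := ⊤ * 𝒜 1 ^ n

@[simp] theorem oddPow_zero : oddPow 𝒜 0 = ⊤ := by rw [oddPow, pow_zero, mul_one]

theorem top_mul_oddPow_le (n : ℕ) : ⊤ * oddPow 𝒜 n ≤ oddPow 𝒜 n := by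
  rw [oddPow, ← mul_assoc]
  exact mul_le_mul_left le_top _

theorem mul_mem_oddPow {n : ℕ} (a : A) {p : A} (hp : p ∈ oddPow 𝒜 n) : a * p ∈ oddPow 𝒜 n :=
  top_mul_oddPow_le 𝒜 n (Submodule.mul_mem_mul Submodule.mem_top hp)

/-- An algebra map `A → C ⊗ A` mapping `A₁` to `C ⊗ A₁` is compatible with the powers of `(A₁)`. -/
theorem map_oddPow_mem {C : Type*} [CommRing C] [Algebra k C] (φ : A →ₐ[k] C ⊗[k] A)
    (hφ : ∀ a ∈ 𝒜 1, φ a ∈ rightSub C (𝒜 1)) {n : ℕ} {a : A} (ha : a ∈ oddPow 𝒜 n) :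
    φ a ∈ rightSub C (oddPow 𝒜 n) := by
  have h1 : (𝒜 1).map φ.toLinearMap ≤ rightSub C (𝒜 1) := Submodule.map_le_iff_le_comap.2 hφ
  have h2 : (oddPow 𝒜 n).map φ.toLinearMap ≤ rightSub C (oddPow 𝒜 n) := by
    rw [oddPow, Submodule.map_mul, Submodule.map_pow]
    refine (mul_le_mul' (le_top.trans_eq rightSub_top.symm)
      ((pow_le_pow_left' h1 n).trans (rightSub_pow_le _ n))).trans (rightSub_mul_le _ _)
  exact h2 (Submodule.mem_map_of_mem ha)

variable [GradedAlgebra 𝒜] [SuperCommutative 𝒜]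

theorem odd_mul_top_le : 𝒜 1 * ⊤ ≤ ⊤ * 𝒜 1 := by
  rw [Submodule.mul_le]
  intro a ha b _
  rw [eq_even_add_odd 𝒜 b, mul_add,
    ← SuperCommutative.even_comm (𝒜 := 𝒜) _ (DirectSum.decompose 𝒜 b 0).2,
    SuperCommutative.odd_anticomm (𝒜 := 𝒜) a ha _ (DirectSum.decompose 𝒜 b 1).2]
  exact add_mem (Submodule.mul_mem_mul Submodule.mem_top ha)
    (neg_mem (Submodule.mul_mem_mul Submodule.mem_top ha))

theorem oddPow_one_mul_le (n : ℕ) : oddPow 𝒜 1 * oddPow 𝒜 n ≤ oddPow 𝒜 (n + 1) := by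
  have h : ⊤ * 𝒜 1 * ⊤ ≤ ⊤ * 𝒜 1 := by
    rw [mul_assoc]
    refine (mul_le_mul_right (odd_mul_top_le 𝒜) ⊤).trans ?_
    rw [← mul_assoc]
    exact mul_le_mul_left le_top _
  calc oddPow 𝒜 1 * oddPow 𝒜 n = ⊤ * 𝒜 1 * ⊤ * 𝒜 1 ^ n := by
        rw [oddPow, oddPow, pow_one, ← mul_assoc]
    _ ≤ ⊤ * 𝒜 1 * 𝒜 1 ^ n := mul_le_mul_left h _
    _ = oddPow 𝒜 (n + 1) := by rw [oddPow, pow_succ', mul_assoc]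

theorem evMk_eq_zero_iff {a : A} : evMk 𝒜 a = 0 ↔ a ∈ oddPow 𝒜 1 := by
  constructor
  · intro h
    have ha : a ∈ oddIdeal 𝒜 := Ideal.Quotient.eq_zero_iff_mem.1 h
    clear h
    induction ha using Submodule.span_induction with
    | zero => exact zero_mem _
    | add x y _ _ hx hy => exact add_mem hx hy
    | smul c x _ hx => exact mul_mem_oddPow 𝒜 c hx
    | mem x hx =>
      rw [← one_mul x, oddPow, pow_one]
      exact Submodule.mul_mem_mul Submodule.mem_top hx
  · intro h
    have : oddPow 𝒜 1 ≤ LinearMap.ker (evMk 𝒜).toLinearMap := by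
      rw [oddPow, pow_one, Submodule.mul_le]
      intro a _ b hb
      rw [LinearMap.mem_ker, AlgHom.toLinearMap_apply, map_mul, evMk_odd 𝒜 hb, mul_zero]
    exact this h

end OddPowers

section Finiteness

variable {k : Type*} [Field k] {A : Type*} [Ring A] [Algebra k A]
  (𝒜 : ZMod 2 → Submodule k A)

theorem odd_mul_self [SuperCommutative 𝒜] (hk : ringChar k ≠ 2) {a : A} (ha : a ∈ 𝒜 1) : a * a = 0 := by
  have h := SuperCommutative.odd_anticomm (𝒜 := 𝒜) a ha a ha
  have h2 : (2 : k) • (a * a) = 0 := by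
    rw [two_smul]
    nth_rewrite 1 [h]
    exact neg_add_cancel _
  exact (smul_eq_zero.1 h2).resolve_left (Ring.two_ne_zero hk)

variable [GradedAlgebra 𝒜]

theorem odd_mul_odd_mem {a b : A} (ha : a ∈ 𝒜 1) (hb : b ∈ 𝒜 1) : a * b ∈ 𝒜 0 :=
  SetLike.mul_mem_graded (A := 𝒜) ha hb

theorem even_mul_odd_mem {a b : A} (ha : a ∈ 𝒜 0) (hb : b ∈ 𝒜 1) : a * b ∈ 𝒜 1 :=
  SetLike.mul_mem_graded (A := 𝒜) ha hb

theorem eq_zero_of_mem_even_of_mem_odd {a : A} (h0 : a ∈ 𝒜 0) (h1 : a ∈ 𝒜 1) : a = 0 := by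
  have e0 := DirectSum.decompose_of_mem_same 𝒜 h0
  have e1 := DirectSum.decompose_of_mem_ne 𝒜 h1 (show (1 : ZMod 2) ≠ 0 by decide)
  exact e0.symm.trans e1

variable [SuperCommutative 𝒜]

/-- `A` as an algebra over its even part. -/
abbrev evenAlgebra : letI := evenCommRing 𝒜; Algebra (𝒜 0) A :=
  letI := evenCommRing 𝒜
  RingHom.toAlgebra' (SetLike.GradeZero.subring 𝒜).subtype
    fun c x => SuperCommutative.even_comm (𝒜 := 𝒜) _ c.2 x

/-- A finitely generated super-commutative algebra is the sum of a finitely generated algebra of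
even elements and of finitely many multiples of that algebra by odd elements. -/
theorem exists_finite_generation [Algebra.FiniteType k A] :
    ∃ (R : Subalgebra k A) (Y : Finset A), R.FG ∧ (∀ r ∈ R, r ∈ 𝒜 0) ∧ (∀ y ∈ Y, y ∈ 𝒜 1) ∧
      Subalgebra.toSubmodule R ⊔ Subalgebra.toSubmodule R * Submodule.span k (Y : Set A) = ⊤ := by
  classical
  obtain ⟨T, hT⟩ := Algebra.FiniteType.out (R := k) (A := A)
  -- `R` is generated by the even parts and by the products of two odd parts of the generators
  let X : Finset A := T.image fun t => (DirectSum.decompose 𝒜 t 0 : A)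
  let Y : Finset A := T.image fun t => (DirectSum.decompose 𝒜 t 1 : A)
  let Z : Finset A := X ∪ (Y ×ˢ Y).image fun p => p.1 * p.2
  let R : Subalgebra k A := Algebra.adjoin k (Z : Set A)
  have hY : ∀ y ∈ Y, y ∈ 𝒜 1 := by
    intro y hy
    obtain ⟨t, _, rfl⟩ := Finset.mem_image.1 hy
    exact (DirectSum.decompose 𝒜 t 1).2
  have hR : ∀ r ∈ R, r ∈ 𝒜 0 := by
    have : R ≤ SetLike.GradeZero.subalgebra 𝒜 := by
      refine Algebra.adjoin_le fun z hz => ?_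
      rcases Finset.mem_union.1 (Finset.mem_coe.1 hz) with hz | hz
      · obtain ⟨t, _, rfl⟩ := Finset.mem_image.1 hz
        exact (DirectSum.decompose 𝒜 t 0).2
      · obtain ⟨p, hp, rfl⟩ := Finset.mem_image.1 hz
        rw [Finset.mem_product] at hp
        exact odd_mul_odd_mem 𝒜 (hY _ hp.1) (hY _ hp.2)
    exact fun r hr => this hr
  refine ⟨R, Y, ⟨Z, rfl⟩, hR, hY, ?_⟩
  set D := Subalgebra.toSubmodule R ⊔ Subalgebra.toSubmodule R * Submodule.span k (Y : Set A)
    with hD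
  have hRD : ∀ r ∈ R, r ∈ D := fun r hr => Submodule.mem_sup_left hr
  have hRYD : ∀ r ∈ R, ∀ y ∈ Y, r * y ∈ D := fun r hr y hy =>
    Submodule.mem_sup_right (Submodule.mul_mem_mul hr (Submodule.subset_span hy))
  have hDle : ∀ Q : Submodule k A, (∀ r ∈ R, r ∈ Q) → (∀ r ∈ R, ∀ y ∈ Y, r * y ∈ Q) → D ≤ Q := by
    intro Q h1 h2
    refine sup_le h1 (Submodule.mul_le.2 fun r hr y hy => ?_)
    have : Submodule.span k (Y : Set A) ≤ Q.comap (LinearMap.mulLeft k r) :=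
      Submodule.span_le.2 fun y hy => h2 r hr y hy
    exact this hy
  -- `D` is stable under left multiplication by the generators of `A`, and contains `1`
  let L : Subalgebra k A :=
    { carrier := {a | ∀ d ∈ D, a * d ∈ D}
      mul_mem' := fun {a b} ha hb d hd => by rw [mul_assoc]; exact ha _ (hb d hd)
      add_mem' := fun {a b} ha hb d hd => by rw [add_mul]; exact add_mem (ha d hd) (hb d hd)
      algebraMap_mem' := fun c d hd => by
        rw [← Algebra.smul_def]; exact D.smul_mem c hd }
  have hL : (⊤ : Subalgebra k A) ≤ L := by
    rw [← hT]
    refine Algebra.adjoin_le fun t ht d hd => ?_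
    have hx : (DirectSum.decompose 𝒜 t 0 : A) ∈ R := Algebra.subset_adjoin
      (Finset.mem_coe.2 (Finset.mem_union_left _ (Finset.mem_image_of_mem _ ht)))
    have hy : (DirectSum.decompose 𝒜 t 1 : A) ∈ Y := Finset.mem_image_of_mem _ ht
    rw [eq_even_add_odd 𝒜 t]
    generalize (DirectSum.decompose 𝒜 t 0 : A) = x at hx
    generalize (DirectSum.decompose 𝒜 t 1 : A) = y at hy
    refine hDle (D.comap (LinearMap.mulLeft k (x + y))) (fun r hr => ?_) (fun r hr y' hy' => ?_) hd
    · change (x + y) * r ∈ D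
      rw [add_mul, ← SuperCommutative.even_comm (𝒜 := 𝒜) r (hR r hr) y]
      exact add_mem (hRD _ (R.mul_mem hx hr)) (hRYD r hr y hy)
    · change (x + y) * (r * y') ∈ D
      rw [add_mul, ← mul_assoc, ← mul_assoc, ← SuperCommutative.even_comm (𝒜 := 𝒜) r (hR r hr) y,
        mul_assoc r]
      refine add_mem (hRYD _ (R.mul_mem hx hr) y' hy') (hRD _ (R.mul_mem hr ?_))
      exact Algebra.subset_adjoin (Finset.mem_coe.2 (Finset.mem_union_right _
        (Finset.mem_image_of_mem (fun p : A × A => p.1 * p.2)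
          (Finset.mem_product.2 ⟨hy, hy'⟩ : (y, y') ∈ Y ×ˢ Y))))
  rw [eq_top_iff]
  intro a _
  have := hL (Algebra.mem_top (x := a)) 1 (hRD 1 R.one_mem)
  rwa [mul_one] at this

theorem even_finiteType [Algebra.FiniteType k A] : Algebra.FiniteType k (𝒜 0) := by
  obtain ⟨R, Y, hfg, hR, hY, htop⟩ := exists_finite_generation 𝒜
  have hRe : SetLike.GradeZero.subalgebra 𝒜 = R := by
    refine le_antisymm (fun a ha => ?_) fun r hr => hR r hr
    have ha0 : a ∈ 𝒜 0 := ha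
    have : a ∈ Subalgebra.toSubmodule R ⊔
        Subalgebra.toSubmodule R * Submodule.span k (Y : Set A) := htop ▸ Submodule.mem_top
    obtain ⟨r, hr, z, hz, hrz⟩ := Submodule.mem_sup.1 this
    have hz1 : z ∈ 𝒜 1 := by
      refine (Submodule.mul_le.2 fun s hs y hy => ?_ : _ ≤ 𝒜 1) hz
      exact even_mul_odd_mem 𝒜 (hR s hs) (Submodule.span_le.2 hY hy)
    have hz0 : z ∈ 𝒜 0 := by
      rw [← add_sub_cancel_left r z, hrz]
      exact sub_mem ha0 (hR r hr)
    rw [← hrz, eq_zero_of_mem_even_of_mem_odd 𝒜 hz0 hz1, add_zero]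
    exact hr
  rw [← hRe] at hfg
  exact (Subalgebra.fg_iff_finiteType _).1 hfg

theorem even_isNoetherianRing [Algebra.FiniteType k A] :
    letI := evenCommRing 𝒜; IsNoetherianRing (𝒜 0) := by
  let _ := evenCommRing 𝒜
  have := even_finiteType 𝒜
  exact Algebra.FiniteType.isNoetherianRing k (𝒜 0)

theorem finite_over_even [Algebra.FiniteType k A] :
    letI := evenCommRing 𝒜; letI := evenAlgebra 𝒜; Module.Finite (𝒜 0) A := by
  let _ := evenCommRing 𝒜
  let _ := evenAlgebra 𝒜
  classical
  obtain ⟨R, Y, hfg, hR, hY, htop⟩ := exists_finite_generation 𝒜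
  refine ⟨insert 1 Y, ?_⟩
  rw [eq_top_iff]
  rintro a -
  set Q := Submodule.span (𝒜 0) ((insert 1 Y : Finset A) : Set A)
  have hmul : ∀ r ∈ R, ∀ q ∈ Q, r * q ∈ Q := fun r hr q hq => Q.smul_mem ⟨r, hR r hr⟩ hq
  have hsub : ∀ y ∈ insert 1 Y, y ∈ Q := fun y hy => Submodule.subset_span hy
  have : a ∈ Subalgebra.toSubmodule R ⊔
      Subalgebra.toSubmodule R * Submodule.span k (Y : Set A) := htop ▸ Submodule.mem_top
  obtain ⟨r, hr, z, hz, rfl⟩ := Submodule.mem_sup.1 this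
  refine add_mem ?_ ?_
  · rw [← mul_one r]
    exact hmul r hr 1 (hsub 1 (Finset.mem_insert_self _ _))
  · clear this
    induction hz using Submodule.mul_induction_on' with
    | add x _ y _ hx hy => exact add_mem hx hy
    | mem_mul_mem s hs y hy =>
      refine hmul s hs y ?_
      induction hy using Submodule.span_induction with
      | zero => exact zero_mem _
      | add x y _ _ hx hy => exact add_mem hx hy
      | mem x hx => exact hsub x (Finset.mem_insert_of_mem hx)
      | smul c x _ hx =>
        rw [Algebra.smul_def]
        exact hmul _ (R.algebraMap_mem c) x hx

/-- The ideal generated by the odd elements is nilpotent. -/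
theorem exists_oddPow_eq_bot (hk : ringChar k ≠ 2) [Algebra.FiniteType k A] :
    ∃ n, oddPow 𝒜 n = ⊥ := by
  let _ := evenCommRing 𝒜
  have := even_isNoetherianRing 𝒜
  obtain ⟨m, hm⟩ := IsNoetherianRing.isNilpotent_nilradical (𝒜 0)
  -- products of two odd elements have square zero, so they generate a nilpotent ideal of `A₀`
  have h1 : 𝒜 1 * 𝒜 1 ≤ ((nilradical (𝒜 0)).restrictScalars k).map (𝒜 0).subtype := by
    rw [Submodule.mul_le]
    intro a ha b hb
    refine ⟨⟨a * b, odd_mul_odd_mem 𝒜 ha hb⟩, ?_, rfl⟩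
    refine mem_nilradical.2 ⟨2, Subtype.ext ?_⟩
    change (a * b) ^ 2 = 0
    rw [sq, mul_assoc, SuperCommutative.odd_anticomm (𝒜 := 𝒜) a ha b hb, mul_neg, ← mul_assoc b,
      odd_mul_self 𝒜 hk hb, zero_mul, neg_zero, mul_zero]
  have h2 : ∀ n, (𝒜 1 * 𝒜 1) ^ (n + 1) ≤
      ((nilradical (𝒜 0) ^ (n + 1)).restrictScalars k).map (𝒜 0).subtype := by
    intro n
    induction n with
    | zero => simpa using h1
    | succ n ih =>
      rw [pow_succ, pow_succ _ (n + 1), Submodule.mul_le]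
      intro x hx y hy
      obtain ⟨x', hx', rfl⟩ := ih hx
      obtain ⟨y', hy', rfl⟩ := h1 hy
      exact ⟨x' * y', Ideal.mul_mem_mul hx' hy', rfl⟩
  refine ⟨2 * (m + 1), ?_⟩
  rw [oddPow, pow_mul, sq]
  have h3 : (𝒜 1 * 𝒜 1) ^ (m + 1) = ⊥ := by
    rw [eq_bot_iff]
    intro x hx
    obtain ⟨x', hx', rfl⟩ := h2 m hx
    rw [pow_succ, hm, zero_mul] at hx'
    have : x' = 0 := hx'
    rw [this]
    exact zero_mem _
  rw [h3, Submodule.mul_bot]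

/-- If `Spec A₀` is connected, then `A / (A₁)` has only the trivial idempotents. -/
theorem eq_zero_or_one_of_isIdempotentElem (hk : ringChar k ≠ 2) [Algebra.FiniteType k A]
    (hconn : IsConnectedGroup 𝒜) (e : EvQuot 𝒜) (he : IsIdempotentElem e) : e = 0 ∨ e = 1 := by
  let _ := evenCommRing 𝒜
  have hconn' : ConnectedSpace (PrimeSpectrum (𝒜 0)) := hconn
  let f : 𝒜 0 →+* EvQuot 𝒜 :=
    ((evMk 𝒜).toRingHom).comp (SetLike.GradeZero.subring 𝒜).subtype
  have hf : ∀ x : 𝒜 0, f x = evMk 𝒜 (x : A) := fun _ => rfl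
  have hker : ∀ x ∈ RingHom.ker f, IsNilpotent x := by
    intro x hx
    have hx1 : (x : A) ∈ oddPow 𝒜 1 := (evMk_eq_zero_iff 𝒜).1 hx
    have hpow : ∀ n, (x : A) ^ n ∈ oddPow 𝒜 n := by
      intro n
      induction n with
      | zero => rw [oddPow_zero]; trivial
      | succ n ih =>
        rw [pow_succ']
        exact oddPow_one_mul_le 𝒜 n (Submodule.mul_mem_mul hx1 ih)
    obtain ⟨n, hn⟩ := exists_oddPow_eq_bot 𝒜 hk
    refine ⟨n, Subtype.ext ?_⟩
    have := hpow n
    rw [hn] at this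
    exact this
  have hrange : e ∈ f.range := by
    obtain ⟨a, rfl⟩ := evMk_surjective 𝒜 e
    refine ⟨DirectSum.decompose 𝒜 a 0, ?_⟩
    conv_rhs => rw [eq_even_add_odd 𝒜 a]
    rw [hf, map_add, evMk_odd 𝒜 (DirectSum.decompose 𝒜 a 1).2, add_zero]
  obtain ⟨e', he', rfl⟩ := exists_isIdempotentElem_eq_of_ker_isNilpotent f hker e hrange he
  rcases isClopen_iff.1 (PrimeSpectrum.isClopen_iff.2 ⟨e', he', rfl⟩) with h | h
  · left
    have : e' = 0 := PrimeSpectrum.basicOpen_injOn_isIdempotentElem he' .zero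
      (SetLike.coe_injective (by rw [h]; simp))
    rw [this, map_zero]
  · right
    have : e' = 1 := PrimeSpectrum.basicOpen_injOn_isIdempotentElem he' .one
      (SetLike.coe_injective (by rw [h]; simp))
    rw [this, map_one]

section Bialgebra

open Coalgebra WithConv

variable [Coalgebra k A] [IsSuperBialgebra 𝒜]

/-- A left ideal of `A` is generated modulo `A⁺P` by finitely many elements, as a vector space. -/
theorem exists_finset_span_sup (𝒜 : ZMod 2 → Submodule k A) [GradedAlgebra 𝒜]
    [SuperCommutative 𝒜] [IsSuperBialgebra 𝒜] [Algebra.FiniteType k A] {P : Submodule k A}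
    (hP : ∀ a, ∀ p ∈ P, a * p ∈ P) :
    ∃ s : Finset A, (∀ x ∈ s, x ∈ P) ∧ P ≤ Submodule.span k (s : Set A) ⊔ augIdeal k A * P := by
  let _ := evenCommRing 𝒜
  let _ := evenAlgebra 𝒜
  have := even_isNoetherianRing 𝒜
  have := finite_over_even 𝒜
  let P' : Submodule (𝒜 0) A :=
    { carrier := P
      zero_mem' := P.zero_mem
      add_mem' := P.add_mem
      smul_mem' := fun r p hp => hP r p hp }
  obtain ⟨s, hs⟩ := (IsNoetherian.noetherian P' : P'.FG)
  have hsP : ∀ x ∈ s, x ∈ P := fun x hx => by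
    have : x ∈ P' := hs ▸ Submodule.subset_span hx
    exact this
  refine ⟨s, hsP, fun p hp => ?_⟩
  have hp' : p ∈ Submodule.span (𝒜 0) (s : Set A) := by rw [hs]; exact hp
  induction hp' using Submodule.span_induction with
  | zero => exact zero_mem _
  | mem x hx => exact Submodule.mem_sup_left (Submodule.subset_span hx)
  | add x y hx hy ihx ihy =>
    rw [hs] at hx hy
    exact add_mem (ihx hx) (ihy hy)
  | smul r x hx ih =>
    have hxP : x ∈ P := by
      rw [hs] at hx
      exact hx
    have e : (r : A) * x = counit (R := k) (r : A) • x +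
        ((r : A) - algebraMap k A (counit (R := k) (r : A))) * x := by
      rw [sub_mul, ← Algebra.smul_def, add_sub_cancel]
    change (r : A) * x ∈ _
    rw [e]
    refine add_mem (Submodule.smul_mem _ _ (ih hxP))
      (Submodule.mem_sup_right (Submodule.mul_mem_mul ?_ hxP))
    rw [mem_augIdeal, map_sub, Algebra.algebraMap_eq_smul_one, map_smul,
      IsSuperBialgebra.counit_one (𝒜 := 𝒜), smul_eq_mul, mul_one, sub_self]

/-- The Artin–Rees lemma for the powers of `A⁺`. -/
theorem exists_augIdeal_pow_inf_le (𝒜 : ZMod 2 → Submodule k A) [GradedAlgebra 𝒜]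
    [SuperCommutative 𝒜] [IsSuperBialgebra 𝒜] [Algebra.FiniteType k A] {P : Submodule k A}
    (hP : ∀ a, ∀ p ∈ P, a * p ∈ P) :
    ∃ n, 0 < n ∧ augIdeal k A ^ n ⊓ P ≤ augIdeal k A * P := by
  let _ := evenCommRing 𝒜
  let _ := evenAlgebra 𝒜
  have := even_isNoetherianRing 𝒜
  have := finite_over_even 𝒜
  let P' : Submodule (𝒜 0) A :=
    { carrier := P
      zero_mem' := P.zero_mem
      add_mem' := P.add_mem
      smul_mem' := fun r p hp => hP r p hp }
  let m : Ideal (𝒜 0) :=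
    { carrier := {r | (r : A) ∈ augIdeal k A}
      zero_mem' := zero_mem (augIdeal k A)
      add_mem' := fun {r s} hr hs => (augIdeal k A).add_mem hr hs
      smul_mem' := fun r s hs =>
        top_mul_augIdeal_le 𝒜 (Submodule.mul_mem_mul (Submodule.mem_top (x := (r : A))) hs) }
  have hright : ∀ (I : Ideal (𝒜 0)) (x b : A), x ∈ I • (⊤ : Submodule (𝒜 0) A) →
      x * b ∈ I • (⊤ : Submodule (𝒜 0) A) := by
    intro I x b hx
    induction hx using Submodule.smul_induction_on' with
    | smul r hr y _ =>
      rw [smul_mul_assoc]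
      exact Submodule.smul_mem_smul hr Submodule.mem_top
    | add x _ y _ hx hy => rw [add_mul]; exact add_mem hx hy
  -- the square of `A⁺` lies in `A₀⁺ A`, because the product of two odd elements is in `A₀⁺`
  have hsq : ∀ x ∈ augIdeal k A ^ 2, x ∈ m • (⊤ : Submodule (𝒜 0) A) := by
    intro x hx
    rw [sq] at hx
    induction hx using Submodule.mul_induction_on' with
    | add x _ y _ hx hy => exact add_mem hx hy
    | mem_mul_mem a ha b hb =>
      have hm : ∀ a ∈ augIdeal k A, DirectSum.decompose 𝒜 a 0 ∈ m := by
        intro a ha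
        change counit (R := k) (DirectSum.decompose 𝒜 a 0 : A) = 0
        rw [mem_augIdeal, eq_even_add_odd 𝒜 a, map_add,
          IsSuperBialgebra.counit_odd (𝒜 := 𝒜) _ (DirectSum.decompose 𝒜 a 1).2, add_zero] at ha
        exact ha
      have ha1 := (DirectSum.decompose 𝒜 a 1).2
      have hb1 := (DirectSum.decompose 𝒜 b 1).2
      have e : a * b = DirectSum.decompose 𝒜 a 0 • b +
          (DirectSum.decompose 𝒜 b 0 • (DirectSum.decompose 𝒜 a 1 : A) +
          (⟨_, odd_mul_odd_mem 𝒜 ha1 hb1⟩ : 𝒜 0) • (1 : A)) := by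
        change a * b = (DirectSum.decompose 𝒜 a 0 : A) * b +
          ((DirectSum.decompose 𝒜 b 0 : A) * (DirectSum.decompose 𝒜 a 1 : A) +
          (DirectSum.decompose 𝒜 a 1 : A) * (DirectSum.decompose 𝒜 b 1 : A) * 1)
        rw [mul_one, SuperCommutative.even_comm (𝒜 := 𝒜) _ (DirectSum.decompose 𝒜 b 0).2,
          ← mul_add, ← eq_even_add_odd 𝒜 b, ← add_mul, ← eq_even_add_odd 𝒜 a]
      rw [e]
      refine add_mem (Submodule.smul_mem_smul (hm a ha) Submodule.mem_top)
        (add_mem (Submodule.smul_mem_smul (hm b hb) Submodule.mem_top)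
          (Submodule.smul_mem_smul ?_ Submodule.mem_top))
      change counit (R := k) (_ * _ : A) = 0
      rw [IsSuperBialgebra.counit_mul (𝒜 := 𝒜), IsSuperBialgebra.counit_odd (𝒜 := 𝒜) _ ha1,
        zero_mul]
  have hpow : ∀ j, ∀ x ∈ augIdeal k A ^ (2 * j), x ∈ m ^ j • (⊤ : Submodule (𝒜 0) A) := by
    intro j
    induction j with
    | zero => intro x _; rw [pow_zero, Submodule.one_smul]; trivial
    | succ j ih =>
      intro x hx
      rw [mul_add, mul_one, pow_add] at hx
      induction hx using Submodule.mul_induction_on' with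
      | add x _ y _ hx hy => exact add_mem hx hy
      | mem_mul_mem x hx y hy =>
        have hx' := ih x hx
        have hy' := hsq y hy
        clear hy
        induction hy' using Submodule.smul_induction_on' with
        | add y _ z _ hy hz => rw [mul_add]; exact add_mem hy hz
        | smul r hr b _ =>
          rw [mul_smul_comm, pow_succ', ← smul_eq_mul m, Submodule.smul_assoc]
          exact Submodule.smul_mem_smul hr (hright _ x b hx')
  obtain ⟨c, hc⟩ := Ideal.exists_pow_inf_eq_pow_smul m P'
  refine ⟨2 * (c + 1), by omega, ?_⟩
  rintro x ⟨hx, hxP⟩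
  have h1 : x ∈ m ^ (c + 1) • (⊤ : Submodule (𝒜 0) A) ⊓ P' := ⟨hpow _ x hx, hxP⟩
  rw [hc (c + 1) (by omega), Nat.add_sub_cancel_left, pow_one] at h1
  have h2 : x ∈ m • P' := Submodule.smul_mono le_rfl inf_le_right h1
  clear h1 hx hxP
  induction h2 using Submodule.smul_induction_on' with
  | add x _ y _ hx hy => exact add_mem hx hy
  | smul r hr p hp => exact Submodule.mul_mem_mul hr hp

/-- A basis of `P / A⁺P` for a left ideal `P` of `A`, with a dual basis which extends to elements
of `hy(G)`. -/
theorem exists_dual_basis [Algebra.FiniteType k A] {P : Submodule k A}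
    (hP : ∀ a, ∀ p ∈ P, a * p ∈ P) :
    ∃ (r : ℕ) (m : Fin r → A) (w : Fin r → (A →ₗ[k] k)), (∀ j, m j ∈ P) ∧
      (∀ j, toConv (w j) ∈ hy 𝒜) ∧ (∀ j, ∀ x ∈ augIdeal k A * P, w j x = 0) ∧
      (∀ i j, w i (m j) = if i = j then 1 else 0) ∧
      ∀ p ∈ P, p - ∑ j, w j p • m j ∈ augIdeal k A * P := by
  obtain ⟨n, hn, hAR⟩ := exists_augIdeal_pow_inf_le 𝒜 hP
  obtain ⟨s, hsP, hs⟩ := exists_finset_span_sup 𝒜 hP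
  have hAP : augIdeal k A * P ≤ P := Submodule.mul_le.2 fun a _ p hp => hP a p hp
  -- `P / A⁺P` embeds into `A / Q`, from which linear forms pull back to `hy(G)`
  let Q : Submodule k A := augIdeal k A * P ⊔ augIdeal k A ^ n
  have hQP : ∀ x ∈ Q, x ∈ P → x ∈ augIdeal k A * P := by
    intro x hx hxP
    obtain ⟨y, hy, z, hz, rfl⟩ := Submodule.mem_sup.1 hx
    refine add_mem hy (hAR ⟨hz, ?_⟩)
    have := sub_mem hxP (hAP hy)
    rwa [add_sub_cancel_left] at this
  let W : Submodule k (A ⧸ Q) := P.map Q.mkQ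
  have hWfin : Module.Finite k W := by
    have hle : W ≤ Submodule.span k (Q.mkQ '' s) := by
      refine Submodule.map_le_iff_le_comap.2 (hs.trans (sup_le ?_ fun x hx => ?_))
      · exact Submodule.span_le.2 fun x hx => Submodule.subset_span ⟨x, hx, rfl⟩
      · have : Q.mkQ x = 0 := (Submodule.Quotient.mk_eq_zero Q).2 (Submodule.mem_sup_left hx)
        rw [Submodule.mem_comap, this]
        exact zero_mem _
    have : Module.Finite k (Submodule.span k (Q.mkQ '' s)) :=
      FiniteDimensional.span_of_finite k (s.finite_toSet.image _)
    exact Submodule.finiteDimensional_of_le hle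
  let b := Module.finBasis k W
  have hm : ∀ j, ∃ x ∈ P, Q.mkQ x = b j := fun j => (b j).2
  choose m hmP hmb using hm
  have hw : ∀ j, ∃ g : (A ⧸ Q) →ₗ[k] k, g ∘ₗ W.subtype = b.coord j :=
    fun j => LinearMap.exists_extend _
  choose g hg using hw
  have hgW : ∀ j (x : W), g j x = b.repr x j := fun j x => LinearMap.congr_fun (hg j) x
  have hQ : ∀ j, ∀ x ∈ Q, g j (Q.mkQ x) = 0 := fun j x hx => by
    have : Q.mkQ x = 0 := (Submodule.Quotient.mk_eq_zero Q).2 hx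
    rw [this, map_zero]
  refine ⟨_, m, fun j => g j ∘ₗ Q.mkQ, hmP,
    fun j => ⟨n, hn, fun x hx => hQ j x (Submodule.mem_sup_right hx)⟩,
    fun j x hx => hQ j x (Submodule.mem_sup_left hx), fun i j => ?_, fun p hp => ?_⟩
  · rw [LinearMap.comp_apply, hmb, hgW, b.repr_self, Finsupp.single_apply]
    simp only [eq_comm]
  · refine hQP _ ?_ (sub_mem hp (sum_mem fun j _ => P.smul_mem _ (hmP j)))
    rw [← Submodule.Quotient.mk_eq_zero Q]
    change Q.mkQ _ = 0
    rw [map_sub, map_sum, sub_eq_zero]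
    let p' : W := ⟨Q.mkQ p, p, hp, rfl⟩
    have := congrArg W.subtype (b.sum_repr p')
    rw [map_sum] at this
    refine this.symm.trans (Finset.sum_congr rfl fun j _ => ?_)
    rw [map_smul, map_smul, hmb, ← hgW]
    rfl

end Bialgebra

end Finiteness

/-! ### The coaction of `O(G_ev)` on `O(G)` and the antipode of `O(G_ev)` -/

section Descent

open Coalgebra WithConv

variable {k : Type*} [Field k]

/-- Convolution inverses descend along a surjective coalgebra map. -/
theorem conv_eq_one_of_comp {D E B : Type*} [AddCommGroup D] [Module k D] [Coalgebra k D]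
    [AddCommGroup E] [Module k E] [Coalgebra k E] [Ring B] [Algebra k B] (p : D →ₗc[k] E)
    (hp : Function.Surjective p) {f g : E →ₗ[k] B}
    (h : toConv (f ∘ₗ p.toLinearMap) * toConv (g ∘ₗ p.toLinearMap) = 1) :
    toConv f * toConv g = 1 := by
  apply ofConv_injective
  ext b
  obtain ⟨a, rfl⟩ := hp b
  have h1 := LinearMap.convMul_comp_coalgHom_distrib (toConv f) (toConv g) p
  have h2 := LinearMap.congr_fun h1 a
  refine h2.trans ((congrArg (fun u : WithConv (D →ₗ[k] B) => u.ofConv a) h).trans ?_)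
  exact congrArg (algebraMap k B) (CoalgHomClass.counit_comp_apply p a).symm

end Descent

section Coaction

open Coalgebra WithConv

variable {k : Type*} [Field k] {A : Type*} [Ring A] [Algebra k A]
  (𝒜 : ZMod 2 → Submodule k A) [GradedAlgebra 𝒜]

/-- A linear map which vanishes on odd elements maps `∑ a₍₁₎ ⊗ a₍₂₎` to `C ⊗ A₁` for odd `a`. -/
theorem leftCoact_odd_mem [Coalgebra k A] [IsSuperBialgebra 𝒜] {C : Type*} [CommRing C] [Algebra k C]
    {g : A →ₗ[k] C} (hg : ∀ a ∈ 𝒜 1, g a = 0) {a : A} (ha : a ∈ 𝒜 1) :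
    leftCoact g a ∈ rightSub C (𝒜 1) := by
  have hle : tensorDegree 𝒜 1 ≤ (rightSub C (𝒜 1)).comap (g.rTensor A) := by
    refine iSup_le fun j => ?_
    rintro _ ⟨t, rfl⟩
    rw [Submodule.mem_comap]
    induction t with
    | zero => rw [map_zero, map_zero]; exact zero_mem _
    | add x y hx hy => rw [map_add, map_add]; exact add_mem hx hy
    | tmul b c =>
      rw [TensorProduct.map_tmul, LinearMap.rTensor_tmul]
      fin_cases j
      · exact tmul_mem_rightSub _ c.2
      · have : g ((𝒜 _).subtype b) = 0 := hg _ b.2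
        rw [this, TensorProduct.zero_tmul]
        exact zero_mem _
  exact hle (IsSuperBialgebra.comul_degree (𝒜 := 𝒜) 1 a ha)

variable [SuperCommutative 𝒜]

/-- The algebra map `A ⊗ A → A / (A₁) ⊗ A` from the super tensor product to the usual one. -/
def evTensorLeft : GradedTensorProduct k 𝒜 𝒜 →ₐ[k] EvQuot 𝒜 ⊗[k] A :=
  GradedTensorProduct.lift 𝒜 𝒜
    (Algebra.TensorProduct.includeLeft.comp (evMk 𝒜)) Algebra.TensorProduct.includeRight (by
      intro i j a b
      rw [AlgHom.comp_apply, Algebra.TensorProduct.includeLeft_apply,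
        Algebra.TensorProduct.includeRight_apply, Algebra.TensorProduct.tmul_mul_tmul,
        Algebra.TensorProduct.tmul_mul_tmul, one_mul, mul_one, one_mul, mul_one]
      fin_cases i
      · change _ = (-1 : ℤˣ) ^ (j * 0) • _
        rw [mul_zero, uzpow_zero, one_smul]
      · rw [evMk_odd 𝒜 a.2, TensorProduct.zero_tmul, smul_zero])

theorem evTensorLeft_of (t : A ⊗[k] A) :
    evTensorLeft 𝒜 (GradedTensorProduct.of k 𝒜 𝒜 t) = (evMk 𝒜).toLinearMap.rTensor A t := by
  induction t with
  | zero => simp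
  | add x y hx hy => rw [map_add, map_add, hx, hy, map_add]
  | tmul a b =>
    refine (GradedTensorProduct.lift_tmul ..).trans ?_
    simp

variable [Coalgebra k A]

/-- If `S` is the antipode of `A`, then `π ∘ S` is a convolution inverse of `π : A → A / (A₁)`, and
it vanishes on odd elements. -/
theorem exists_isTwistPair_evMk [IsSuperHopfAlgebra 𝒜] :
    ∃ σ : A →ₗ[k] EvQuot 𝒜, IsTwistPair (evMk 𝒜) σ ∧ ∀ a ∈ 𝒜 1, σ a = 0 := by
  obtain ⟨S, hS, h1, h2⟩ := IsSuperHopfAlgebra.exists_antipode (𝒜 := 𝒜)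
  have h1' : toConv S * toConv LinearMap.id = 1 := WithConv.ext h1
  have h2' : toConv LinearMap.id * toConv S = 1 := WithConv.ext h2
  refine ⟨(evMk 𝒜).toLinearMap ∘ₗ S, ⟨?_, ?_, ?_, ?_⟩, fun a ha => evMk_odd 𝒜 (hS 1 a ha)⟩
  · apply ofConv_injective
    have := LinearMap.algHom_comp_convMul_distrib (evMk 𝒜) (toConv S) (toConv LinearMap.id)
    rw [h1'] at this
    refine this.symm.trans ?_
    ext a
    simp
  · apply ofConv_injective
    have := LinearMap.algHom_comp_convMul_distrib (evMk 𝒜) (toConv LinearMap.id) (toConv S)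
    rw [h2'] at this
    refine this.symm.trans ?_
    ext a
    simp
  · rw [leftCoact, LinearMap.comp_apply, IsSuperBialgebra.comul_one (𝒜 := 𝒜)]
    simp [Algebra.TensorProduct.one_def]
  · intro a b
    rw [leftCoact, LinearMap.comp_apply, LinearMap.comp_apply, LinearMap.comp_apply,
      ← evTensorLeft_of, ← evTensorLeft_of, ← evTensorLeft_of,
      IsSuperBialgebra.comul_mul (𝒜 := 𝒜), map_mul]

/-- The bialgebra `A / (A₁)` has an antipode. -/
theorem exists_antipode_evQuot [IsSuperHopfAlgebra 𝒜] :
    ∃ S : EvQuot 𝒜 →ₗ[k] EvQuot 𝒜, toConv S * toConv LinearMap.id = 1 ∧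
      toConv LinearMap.id * toConv S = 1 := by
  obtain ⟨σ, hσ, hodd⟩ := exists_isTwistPair_evMk 𝒜
  have hker : ∀ a, (evMkCoalgHom 𝒜).toLinearMap a = 0 → σ a = 0 := by
    intro a ha
    have hle : oddPow 𝒜 1 ≤ LinearMap.ker σ := by
      rw [oddPow, pow_one, Submodule.mul_le]
      intro a _ b hb
      rw [LinearMap.mem_ker, hσ.antipode_mul (IsSuperBialgebra.counit_mul (𝒜 := 𝒜)), hodd b hb,
        mul_zero]
    exact hle ((evMk_eq_zero_iff 𝒜).1 ha)
  obtain ⟨S, hS⟩ := exists_comp_eq_of_surjective (q := (evMkCoalgHom 𝒜).toLinearMap)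
    (evMk_surjective 𝒜) hker
  refine ⟨S, ?_, ?_⟩
  · apply conv_eq_one_of_comp (evMkCoalgHom 𝒜) (evMk_surjective 𝒜)
    rw [hS]
    exact hσ.conv_left
  · apply conv_eq_one_of_comp (evMkCoalgHom 𝒜) (evMk_surjective 𝒜)
    rw [hS]
    exact hσ.conv_right

theorem toHyEvDual_injective [IsSuperHopfAlgebra 𝒜] (hk : ringChar k ≠ 2) [Algebra.FiniteType k A]
    (hconn : IsConnectedGroup 𝒜) : Function.Injective (toHyEvDual 𝒜) := by
  obtain ⟨S, h1, h2⟩ := exists_antipode_evQuot 𝒜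
  have : Algebra.FiniteType k (EvQuot 𝒜) :=
    Algebra.FiniteType.of_surjective (evMk 𝒜) (evMk_surjective 𝒜)
  have : IsNoetherianRing (EvQuot 𝒜) := Algebra.FiniteType.isNoetherianRing k _
  exact toHyDual_injective_of_isIdempotentElem h1 h2
    (eq_zero_or_one_of_isIdempotentElem 𝒜 hk hconn)

end Coaction

/-! ### The layers of the filtration by the powers of `(A₁)` -/

section TensorLemmas

open WithConv

variable {k : Type*} [Field k] {A : Type*} [Ring A] [Algebra k A]
  {C : Type*} [CommRing C] [Algebra k C]

theorem tmul_one_mul_mem_rightSub {P : Submodule k A} (c : C) {z : C ⊗[k] A}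
    (hz : z ∈ rightSub C P) : (c ⊗ₜ[k] (1 : A)) * z ∈ rightSub C P := by
  refine (rightSub_le (Q := (rightSub C P).comap (LinearMap.mulLeft k (c ⊗ₜ[k] (1 : A))))
    fun b p hp => ?_) hz
  rw [Submodule.mem_comap, LinearMap.mulLeft_apply, Algebra.TensorProduct.tmul_mul_tmul, one_mul]
  exact tmul_mem_rightSub (c * b) hp

theorem slice_tmul_one_mul (w : A →ₗ[k] k) (c : C) (z : C ⊗[k] A) :
    slice C w ((c ⊗ₜ 1) * z) = c * slice C w z := by
  induction z with
  | zero => simp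
  | add x y hx hy => rw [mul_add, map_add, hx, hy, map_add, mul_add]
  | tmul b a =>
    rw [Algebra.TensorProduct.tmul_mul_tmul, one_mul, slice_tmul, slice_tmul, mul_smul_comm]

theorem mulMap_tmul_one_mul (q : A →ₐ[k] C) (c : C) (z : C ⊗[k] A) :
    mulMap q ((c ⊗ₜ 1) * z) = c * mulMap q z := by
  induction z with
  | zero => simp
  | add x y hx hy => rw [mul_add, map_add, hx, hy, map_add, mul_add]
  | tmul b a =>
    rw [Algebra.TensorProduct.tmul_mul_tmul, one_mul, mulMap_tmul, mulMap_tmul, mul_assoc]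

/-- If `m` spans `P` modulo `P'`, with coordinates `w`, then the slices of an element of `C ⊗ P`
along `w` are its coordinates modulo `C ⊗ P'`. -/
theorem sub_sum_slice_mem {P P' : Submodule k A} {r : ℕ} {m : Fin r → A}
    {w : Fin r → (A →ₗ[k] k)} (hmw : ∀ p ∈ P, p - ∑ j, w j p • m j ∈ P') {z : C ⊗[k] A}
    (hz : z ∈ rightSub C P) : z - ∑ j, slice C (w j) z ⊗ₜ[k] m j ∈ rightSub C P' := by
  let Φ : C ⊗[k] A →ₗ[k] C ⊗[k] A :=
    LinearMap.id - ∑ j, (TensorProduct.mk k C A).flip (m j) ∘ₗ slice C (w j)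
  have hΦ : ∀ z, Φ z = z - ∑ j, slice C (w j) z ⊗ₜ[k] m j := fun z => by simp [Φ]
  rw [← hΦ]
  refine (rightSub_le (Q := (rightSub C P').comap Φ) fun c p hp => ?_) hz
  rw [Submodule.mem_comap, hΦ]
  have : c ⊗ₜ[k] p - ∑ j, slice C (w j) (c ⊗ₜ[k] p) ⊗ₜ[k] m j =
      c ⊗ₜ (p - ∑ j, w j p • m j) := by
    rw [TensorProduct.tmul_sub, TensorProduct.tmul_sum]
    simp only [slice_tmul, TensorProduct.smul_tmul]
  rw [this]
  exact tmul_mem_rightSub c (hmw p hp)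

end TensorLemmas

section Graded

open Coalgebra WithConv

variable {k : Type*} [Field k] {A : Type*} [Ring A] [Algebra k A]

theorem apply_mul_of_forall_augIdeal_mul (𝒜 : ZMod 2 → Submodule k A)
    [GradedAlgebra 𝒜] [Coalgebra k A] [IsSuperBialgebra 𝒜] {P : Submodule k A}
    {w : A →ₗ[k] k} (hw : ∀ x ∈ augIdeal k A * P, w x = 0) (c : A) {p : A} (hp : p ∈ P) :
    w (c * p) = counit (R := k) c * w p := by
  have h : c - algebraMap k A (counit (R := k) c) ∈ augIdeal k A := by
    rw [mem_augIdeal, map_sub, Algebra.algebraMap_eq_smul_one, map_smul,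
      IsSuperBialgebra.counit_one (𝒜 := 𝒜), smul_eq_mul, mul_one, sub_self]
  have := hw _ (Submodule.mul_mem_mul h hp)
  rw [sub_mul, ← Algebra.smul_def, map_sub, map_smul, sub_eq_zero] at this
  exact this

variable (𝒜 : ZMod 2 → Submodule k A) [GradedAlgebra 𝒜] [SuperCommutative 𝒜] [Coalgebra k A]

/-- For a linear form `w` on `A`, the map `A → A / (A₁)`, `a ↦ ∑ w a₍₂₎ • π a₍₁₎`. -/
def coactSlice (w : A →ₗ[k] k) : A →ₗ[k] EvQuot 𝒜 :=
  slice (EvQuot 𝒜) w ∘ₗ leftCoact (evMk 𝒜).toLinearMap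

theorem coactSlice_apply (w : A →ₗ[k] k) (a : A) :
    coactSlice 𝒜 w a = slice (EvQuot 𝒜) w (leftCoact (evMk 𝒜).toLinearMap a) := rfl

theorem hyIncl_mul_apply [IsSuperBialgebra 𝒜] (x : hyEv 𝒜) (w : hy 𝒜) (a : A) :
    (hyIncl 𝒜 x * w).1.ofConv a = x.1.ofConv (coactSlice 𝒜 w.1.ofConv a) :=
  (apply_slice_leftCoact (evMk 𝒜).toLinearMap x.1.ofConv w.1.ofConv a).symm

variable [IsSuperBialgebra 𝒜] {σ : A →ₗ[k] EvQuot 𝒜} (hσ : IsTwistPair (evMk 𝒜) σ)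
  (hodd : ∀ a ∈ 𝒜 1, σ a = 0)

include hσ

theorem leftCoact_mem_oddPow {n : ℕ} {a : A} (ha : a ∈ oddPow 𝒜 n) :
    leftCoact (evMk 𝒜).toLinearMap a ∈ rightSub (EvQuot 𝒜) (oddPow 𝒜 n) :=
  map_oddPow_mem 𝒜 hσ.coactHom (fun _ hb => leftCoact_odd_mem 𝒜 (fun _ hc => evMk_odd 𝒜 hc) hb) ha

include hodd in
theorem twist_mem_oddPow {n : ℕ} {z : EvQuot 𝒜 ⊗[k] A}
    (hz : z ∈ rightSub (EvQuot 𝒜) (oddPow 𝒜 n)) :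
    twist σ z ∈ rightSub (EvQuot 𝒜) (oddPow 𝒜 n) := by
  refine (rightSub_le (Q := (rightSub _ _).comap (twist σ)) fun c p hp => ?_) hz
  rw [Submodule.mem_comap, twist_tmul]
  exact tmul_one_mul_mem_rightSub c
    (map_oddPow_mem 𝒜 hσ.antipodeHom (fun _ hb => leftCoact_odd_mem 𝒜 hodd hb) hp)

/-- The maps `coactSlice` are linear over `A / (A₁)` on `(A₁)ⁿ`. -/
theorem coactSlice_mul {n : ℕ} {w : A →ₗ[k] k} (hw : ∀ x ∈ augIdeal k A * oddPow 𝒜 n, w x = 0)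
    (c : A) {p : A} (hp : p ∈ oddPow 𝒜 n) :
    coactSlice 𝒜 w (c * p) = evMk 𝒜 c * coactSlice 𝒜 w p := by
  rw [coactSlice_apply, coactSlice_apply, hσ.coact_mul,
    slice_mul (fun a p hp => apply_mul_of_forall_augIdeal_mul 𝒜 hw a hp) _
      (leftCoact_mem_oddPow 𝒜 hσ hp), slice_counit_leftCoact]
  rfl

include hodd

/-- The map `(A₁)ⁿ → A / (A₁) ⊗ (A₁)ⁿ / A⁺(A₁)ⁿ` is surjective. -/
theorem exists_coactSlice_eq {n r : ℕ} {m : Fin r → A} {w : Fin r → (A →ₗ[k] k)}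
    (hm : ∀ j, m j ∈ oddPow 𝒜 n) (hw : ∀ j, ∀ x ∈ augIdeal k A * oddPow 𝒜 n, w j x = 0)
    (hwm : ∀ i j, w i (m j) = if i = j then 1 else 0) (b : Fin r → EvQuot 𝒜) :
    ∃ a ∈ oddPow 𝒜 n, ∀ j, coactSlice 𝒜 (w j) a = b j := by
  obtain ⟨s, hs⟩ := LinearMap.exists_rightInverse_of_surjective (evMk 𝒜).toLinearMap
    (LinearMap.range_eq_top.2 (evMk_surjective 𝒜))
  have hs' : ∀ c, evMk 𝒜 (s c) = c := LinearMap.congr_fun hs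
  let t : EvQuot 𝒜 ⊗[k] A := ∑ j, b j ⊗ₜ m j
  have ht : twist σ t ∈ rightSub (EvQuot 𝒜) (oddPow 𝒜 n) :=
    twist_mem_oddPow 𝒜 hσ hodd (sum_mem fun j _ => tmul_mem_rightSub (b j) (hm j))
  refine ⟨contract s (twist σ t), contract_mem (fun a p hp => mul_mem_oddPow 𝒜 a hp) ht,
    fun i => ?_⟩
  have key : ∀ z ∈ rightSub (EvQuot 𝒜) (oddPow 𝒜 n), coactSlice 𝒜 (w i) (contract s z) =
      slice (EvQuot 𝒜) (w i) (twist (evMk 𝒜).toLinearMap z) := by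
    intro z hz
    refine (rightSub_le (Q := LinearMap.eqLocus (coactSlice 𝒜 (w i) ∘ₗ contract s)
      (slice (EvQuot 𝒜) (w i) ∘ₗ twist (evMk 𝒜).toLinearMap)) fun c p hp => ?_) hz
    change coactSlice 𝒜 (w i) (s c * p) =
      slice (EvQuot 𝒜) (w i) ((c ⊗ₜ 1) * leftCoact (evMk 𝒜).toLinearMap p)
    rw [coactSlice_mul 𝒜 hσ (hw i) _ hp, hs', slice_tmul_one_mul, coactSlice_apply]
  rw [key _ ht, hσ.twist_twist, map_sum]
  simp [hwm]

/-- The map `(A₁)ⁿ → A / (A₁) ⊗ (A₁)ⁿ / A⁺(A₁)ⁿ` has the kernel `(A₁)ⁿ⁺¹`. -/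
theorem mem_oddPow_succ_of_coactSlice_eq_zero {n r : ℕ} {m : Fin r → A} {w : Fin r → (A →ₗ[k] k)}
    (hmw : ∀ p ∈ oddPow 𝒜 n, p - ∑ j, w j p • m j ∈ augIdeal k A * oddPow 𝒜 n) {a : A}
    (ha : a ∈ oddPow 𝒜 n) (ha0 : ∀ j, coactSlice 𝒜 (w j) a = 0) : a ∈ oddPow 𝒜 (n + 1) := by
  obtain ⟨s, hs⟩ := LinearMap.exists_rightInverse_of_surjective (evMk 𝒜).toLinearMap
    (LinearMap.range_eq_top.2 (evMk_surjective 𝒜))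
  have hs' : ∀ c, evMk 𝒜 (s c) = c := LinearMap.congr_fun hs
  have hker : ∀ y, evMk 𝒜 y = 0 → ∀ p ∈ oddPow 𝒜 n, y * p ∈ oddPow 𝒜 (n + 1) := fun y hy p hp =>
    oddPow_one_mul_le 𝒜 n (Submodule.mul_mem_mul ((evMk_eq_zero_iff 𝒜).1 hy) hp)
  have h1 : leftCoact (evMk 𝒜).toLinearMap a ∈
      rightSub (EvQuot 𝒜) (augIdeal k A * oddPow 𝒜 n) := by
    have := sub_sum_slice_mem hmw (leftCoact_mem_oddPow 𝒜 hσ ha)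
    rwa [Finset.sum_eq_zero, sub_zero] at this
    intro j _
    rw [← coactSlice_apply, ha0 j, TensorProduct.zero_tmul]
  have h2 : ∀ z ∈ rightSub (EvQuot 𝒜) (augIdeal k A * oddPow 𝒜 n),
      contract s (twist σ z) ∈ oddPow 𝒜 (n + 1) := by
    intro z hz
    refine (rightSub_le (Q := (oddPow 𝒜 (n + 1)).comap (contract s ∘ₗ twist σ))
      fun c x hx => ?_) hz
    rw [Submodule.mem_comap, LinearMap.comp_apply]
    induction hx using Submodule.mul_induction_on' with
    | add x _ y _ hx hy => rw [TensorProduct.tmul_add, map_add, map_add]; exact add_mem hx hy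
    | mem_mul_mem y hy p hp =>
      have e : c ⊗ₜ[k] (y * p) = (c ⊗ₜ y) * (1 ⊗ₜ p) := by
        rw [Algebra.TensorProduct.tmul_mul_tmul, mul_one]
      have := contract_mul_sub_mem hs' hker (twist σ (c ⊗ₜ[k] y))
        (twist_mem_oddPow 𝒜 hσ hodd (tmul_mem_rightSub 1 hp))
      rw [← hσ.twist_antipode_mul, ← e, twist_tmul (g := σ) (b := c) (a := y), mulMap_tmul_one_mul,
        mulMap_leftCoact hσ, mem_augIdeal.1 hy, map_zero, mul_zero, map_zero, zero_mul,
        sub_zero] at this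
      exact this
  -- untwisting the coaction of `a` gives back `1 ⊗ a`
  have h3 := h2 _ h1
  rw [← hσ.coactHom_apply, hσ.twist_coactHom, contract_tmul] at h3
  have h4 := sub_mem h3 (hker (s 1 - 1) (by rw [map_sub, hs', map_one, sub_self]) a ha)
  rwa [sub_mul, one_mul, sub_sub_cancel] at h4

end Graded

section Layers

open Coalgebra WithConv

variable {k : Type*} [Field k] {A : Type*} [Ring A] [Algebra k A]
  (𝒜 : ZMod 2 → Submodule k A) [GradedAlgebra 𝒜] [SuperCommutative 𝒜] [Coalgebra k A]
  [IsSuperHopfAlgebra 𝒜]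

theorem evMk_mem_augIdeal_pow (n : ℕ) {b : EvQuot 𝒜} (hb : b ∈ augIdeal k (EvQuot 𝒜) ^ n) :
    ∃ c ∈ augIdeal k A ^ n, evMk 𝒜 c = b := by
  have h1 : augIdeal k (EvQuot 𝒜) ≤ (augIdeal k A).map (evMk 𝒜).toLinearMap := by
    intro b hb
    obtain ⟨a, rfl⟩ := evMk_surjective 𝒜 b
    exact ⟨a, hb, rfl⟩
  have h2 := pow_le_pow_left' h1 n hb
  rw [← Submodule.map_pow] at h2
  exact h2

variable [Algebra.FiniteType k A]

/-- The structure of the layer `(A₁)ⁿ / (A₁)ⁿ⁺¹`: the maps `coactSlice (w j)` for suitable `w j` in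
`hy(G)` identify it with `(A / (A₁))ʳ`, and any element of `hy(G)` which vanishes on `(A₁)ⁿ⁺¹` agrees
on `(A₁)ⁿ` with an element of `∑ hy(G_ev) * w j`. -/
theorem exists_layer (n : ℕ) :
    ∃ (r : ℕ) (w : Fin r → hy 𝒜),
      (∀ b : Fin r → EvQuot 𝒜, ∃ a ∈ oddPow 𝒜 n,
        ∀ j, coactSlice 𝒜 (w j).1.ofConv a = b j) ∧
      (∀ a ∈ oddPow 𝒜 n, (∀ j, coactSlice 𝒜 (w j).1.ofConv a = 0) → a ∈ oddPow 𝒜 (n + 1)) ∧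
      ∀ u : hy 𝒜, (∀ a ∈ oddPow 𝒜 (n + 1), u.1.ofConv a = 0) → ∃ x : Fin r → hyEv 𝒜,
        ∀ a ∈ oddPow 𝒜 n, u.1.ofConv a = ∑ j, (x j).1.ofConv (coactSlice 𝒜 (w j).1.ofConv a) := by
  obtain ⟨σ, hσ, hodd⟩ := exists_isTwistPair_evMk 𝒜
  obtain ⟨r, m, w, hm, hwy, hw, hwm, hmw⟩ :=
    exists_dual_basis 𝒜 (P := oddPow 𝒜 n) (fun a p hp => mul_mem_oddPow 𝒜 a hp)
  have hS := exists_coactSlice_eq 𝒜 hσ hodd hm hw hwm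
  have hK : ∀ a ∈ oddPow 𝒜 n, (∀ j, coactSlice 𝒜 (w j) a = 0) → a ∈ oddPow 𝒜 (n + 1) :=
    fun a ha ha0 => mem_oddPow_succ_of_coactSlice_eq_zero 𝒜 hσ hodd hmw ha ha0
  refine ⟨r, fun j => ⟨toConv (w j), hwy j⟩, hS, hK, fun u hu => ?_⟩
  obtain ⟨s, hs⟩ := LinearMap.exists_rightInverse_of_surjective (evMk 𝒜).toLinearMap
    (LinearMap.range_eq_top.2 (evMk_surjective 𝒜))
  have hs' : ∀ c, evMk 𝒜 (s c) = c := LinearMap.congr_fun hs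
  choose p hp hpw using fun i => hS (Pi.single i 1)
  obtain ⟨N, hN, huN⟩ := u.2
  -- `x i` is `b ↦ u (c * p i)` for any lift `c` of `b` to `A`
  have hlift : ∀ i c, u.1.ofConv (s (evMk 𝒜 c) * p i) = u.1.ofConv (c * p i) := by
    intro i c
    rw [← sub_eq_zero, ← map_sub, ← sub_mul]
    refine hu _ (oddPow_one_mul_le 𝒜 n (Submodule.mul_mem_mul ?_ (hp i)))
    rw [← evMk_eq_zero_iff, map_sub, hs', sub_self]
  refine ⟨fun i => ⟨toConv (u.1.ofConv ∘ₗ LinearMap.mulRight k (p i) ∘ₗ s), N, hN, ?_⟩, ?_⟩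
  · intro b hb
    obtain ⟨c, hc, rfl⟩ := evMk_mem_augIdeal_pow 𝒜 N hb
    change u.1.ofConv (s (evMk 𝒜 c) * p i) = 0
    rw [hlift]
    have hright : augIdeal k A ^ N * ⊤ ≤ augIdeal k A ^ N := by
      obtain ⟨M, rfl⟩ := Nat.exists_eq_succ_of_ne_zero hN.ne'
      rw [pow_succ, mul_assoc]
      exact mul_le_mul_right (augIdeal_mul_top_le 𝒜) _
    exact huN _ (hright (Submodule.mul_mem_mul hc Submodule.mem_top))
  · intro a ha
    have h1 : a - ∑ i, s (coactSlice 𝒜 (w i) a) * p i ∈ oddPow 𝒜 (n + 1) := by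
      refine hK _ (sub_mem ha (sum_mem fun i _ => mul_mem_oddPow 𝒜 _ (hp i))) fun j => ?_
      rw [map_sub, map_sum, sub_eq_zero, Finset.sum_eq_single j]
      · rw [coactSlice_mul 𝒜 hσ (hw j) _ (hp j), hs', hpw, Pi.single_eq_same, mul_one]
      · intro i _ hij
        rw [coactSlice_mul 𝒜 hσ (hw j) _ (hp i), hpw, Pi.single_eq_of_ne hij.symm, mul_zero]
      · exact fun h => absurd (Finset.mem_univ j) h
    have h2 := hu _ h1
    rw [map_sub, map_sum, sub_eq_zero] at h2
    exact h2

/-- If the elements of `hy(G_ev)` separate `A / (A₁)`, then those of `hy(G)` separate `A`. -/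
theorem toHyDual_injective (hk : ringChar k ≠ 2)
    (hev : Function.Injective (toHyEvDual 𝒜)) : Function.Injective (toHyDual 𝒜) := by
  rw [injective_iff_map_eq_zero]
  intro a ha
  rw [toHyDual_eq_zero_iff] at ha
  have hmem : ∀ n, a ∈ oddPow 𝒜 n := by
    intro n
    induction n with
    | zero => rw [oddPow_zero]; trivial
    | succ n ih =>
      obtain ⟨r, w, -, hK, -⟩ := exists_layer 𝒜 n
      refine hK a ih fun j => hev ?_
      rw [map_zero, toHyDual_eq_zero_iff]
      intro x hx
      have := ha _ (hyIncl 𝒜 ⟨x, hx⟩ * w j).2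
      rwa [hyIncl_mul_apply] at this
  obtain ⟨n, hn⟩ := exists_oddPow_eq_bot 𝒜 hk
  have := hmem n
  rwa [hn] at this

/-- A linear form `f` on `hy(G)`, with `f (x y) = ⟨x, F y⟩` for `x` in `hy(G_ev)` and a map `F` to
`O(G_ev)`, is the evaluation at an element of `A`. -/
theorem exists_eq_eval (hk : ringChar k ≠ 2) (f : Module.Dual k (hy 𝒜)) (F : hy 𝒜 → EvQuot 𝒜)
    (hF : ∀ (x : hyEv 𝒜) (y : hy 𝒜), f (hyIncl 𝒜 x * y) = x.1.ofConv (F y)) :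
    ∃ a : A, ∀ y : hy 𝒜, f y = y.1.ofConv a := by
  have key : ∀ n, ∃ a : A, ∀ y : hy 𝒜, (∀ p ∈ oddPow 𝒜 n, y.1.ofConv p = 0) →
      f y = y.1.ofConv a := by
    intro n
    induction n with
    | zero =>
      refine ⟨0, fun y hy => ?_⟩
      have : y = 0 := Subtype.ext (WithConv.ext (LinearMap.ext fun p =>
        hy p (by rw [oddPow_zero]; trivial)))
      rw [this, map_zero]
      rfl
    | succ n ih =>
      obtain ⟨a, ha⟩ := ih
      obtain ⟨r, w, hS, -, hK⟩ := exists_layer 𝒜 n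
      obtain ⟨a', ha', haw⟩ := hS fun j => F (w j) - coactSlice 𝒜 (w j).1.ofConv a
      refine ⟨a + a', fun u hu => ?_⟩
      obtain ⟨x, hx⟩ := hK u hu
      -- `u - v` vanishes on `(A₁)ⁿ`
      let v : hy 𝒜 := ∑ j, hyIncl 𝒜 (x j) * w j
      have hv : ∀ c, v.1.ofConv c =
          ∑ j, (x j).1.ofConv (coactSlice 𝒜 (w j).1.ofConv c) := by
        intro c
        have h1 := map_sum (evalHy 𝒜 c) (fun j => hyIncl 𝒜 (x j) * w j) Finset.univ
        refine h1.trans (Finset.sum_congr rfl fun j _ => ?_)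
        exact hyIncl_mul_apply 𝒜 (x j) (w j) c
      have h1 : f (u + (-1 : k) • v) = (u + (-1 : k) • v).1.ofConv a := by
        refine ha _ fun p hp => ?_
        change u.1.ofConv p + (-1 : k) • v.1.ofConv p = 0
        rw [hv, hx p hp, neg_one_smul, add_neg_cancel]
      have h2 : f v = ∑ j, (x j).1.ofConv (F (w j)) := by
        rw [map_sum]
        exact Finset.sum_congr rfl fun j _ => hF (x j) (w j)
      have h3 : (u + (-1 : k) • v).1.ofConv a = u.1.ofConv a + (-1 : k) • v.1.ofConv a := rfl
      rw [map_add, map_smul, h3, h2, hv, neg_one_smul, neg_one_smul, ← sub_eq_add_neg,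
        ← sub_eq_add_neg, sub_eq_iff_eq_add] at h1
      rw [h1, map_add, hx a' ha', sub_add, sub_eq_add_neg, neg_sub, ← Finset.sum_sub_distrib]
      simp only [haw, map_sub]
  obtain ⟨n, hn⟩ := exists_oddPow_eq_bot 𝒜 hk
  obtain ⟨a, ha⟩ := key n
  refine ⟨a, fun y => ha y fun p hp => ?_⟩
  rw [hn, Submodule.mem_bot] at hp
  rw [hp, map_zero]


end Layers

/-! ### Subcomodules of `hy(G)°` -/

section Pairings

variable {k : Type*} [Field k]

/-- If `ρ ∘ g = ι ∘ π`, then `∑ ρ (g b) ⊗ g c` lies in the image of `E ⊗ g(V)` under `ι`. -/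
theorem rTensor_map_mem_range {V U E X : Type*} [AddCommMonoid V] [Module k V] [AddCommMonoid U]
    [Module k U] [AddCommMonoid E] [Module k E] [AddCommMonoid X] [Module k X] {g : V →ₗ[k] U}
    {ρ : U →ₗ[k] X} {π : V →ₗ[k] E} {ι : E →ₗ[k] X} (h : ρ ∘ₗ g = ι ∘ₗ π) (t : V ⊗[k] V) :
    ρ.rTensor U (TensorProduct.map g g t) ∈
      LinearMap.range (TensorProduct.map ι (LinearMap.range g).subtype) := by
  induction t with
  | zero => rw [map_zero, map_zero]; exact zero_mem _
  | add x y hx hy => rw [map_add, map_add]; exact add_mem hx hy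
  | tmul b c =>
    refine ⟨π b ⊗ₜ ⟨g c, c, rfl⟩, ?_⟩
    rw [TensorProduct.map_tmul, TensorProduct.map_tmul, LinearMap.rTensor_tmul,
      ← LinearMap.comp_apply ρ, h]
    rfl

theorem pairing_rTensor_tmul {U X M M' : Type*} [AddCommMonoid U] [Module k U] [AddCommMonoid X]
    [Module k X] [AddCommMonoid M] [Module k M] [AddCommMonoid M'] [Module k M']
    {e : X →ₗ[k] Module.Dual k M} {e' : U →ₗ[k] Module.Dual k M'} {ρ : U →ₗ[k] X} {i : M → M'}
    (h : ∀ v x, e (ρ v) x = e' v (i x)) (t : U ⊗[k] U) (x : M) (y : M') :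
    pairing e e' (ρ.rTensor U t) (x ⊗ₜ y) = pairing e' e' t (i x ⊗ₜ y) := by
  induction t with
  | zero => simp
  | add a b ha hb => rw [map_add, map_add, LinearMap.add_apply, ha, hb, map_add,
      LinearMap.add_apply]
  | tmul a b => rw [LinearMap.rTensor_tmul, pairing_tmul, pairing_tmul, h]

/-- Contracting an element of `E ⊗ N` in the second factor gives a map `F : M' → E`. -/
theorem exists_pairing_map_eq {U X E M M' : Type*} [AddCommMonoid U] [Module k U] [AddCommMonoid X]
    [Module k X] [AddCommMonoid E] [Module k E] [AddCommMonoid M] [Module k M] [AddCommMonoid M']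
    [Module k M'] (e : X →ₗ[k] Module.Dual k M) (e' : U →ₗ[k] Module.Dual k M') (ι : E →ₗ[k] X)
    (N : Submodule k U) (t : E ⊗[k] N) :
    ∃ F : M' → E, ∀ x y, pairing e e' (TensorProduct.map ι N.subtype t) (x ⊗ₜ y) =
      e (ι (F y)) x := by
  induction t with
  | zero => exact ⟨0, fun x y => by simp⟩
  | add a b ha hb =>
    obtain ⟨F, hF⟩ := ha
    obtain ⟨G, hG⟩ := hb
    refine ⟨fun y => F y + G y, fun x y => ?_⟩
    rw [map_add, map_add, LinearMap.add_apply, hF, hG, map_add, map_add, LinearMap.add_apply]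
  | tmul b g =>
    refine ⟨fun y => e' g.1 y • b, fun x y => ?_⟩
    rw [TensorProduct.map_tmul, pairing_tmul, map_smul, map_smul, LinearMap.smul_apply, smul_eq_mul,
      mul_comm]
    rfl

end Pairings

section Comodule

open Coalgebra WithConv

variable {k : Type*} [Field k] {A : Type*} [Ring A] [Algebra k A]
  (𝒜 : ZMod 2 → Submodule k A) [GradedAlgebra 𝒜] [SuperCommutative 𝒜] [Coalgebra k A]
  [IsSuperBialgebra 𝒜]

theorem hyDualComodule_coact (f : HyDual 𝒜) :
    (hyDualComodule 𝒜).coact f =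
      (FiniteDual.map (hyIncl 𝒜)).toLinearMap.rTensor (HyDual 𝒜) (comul (R := k) f) := rfl

/-- The image of `O(G)` in `hy(G)°` is an `O(G_ev)`-subcomodule. -/
theorem isSubcomoduleOver_range : (hyDualComodule 𝒜).IsSubcomoduleOver (toHyEvDual 𝒜)
    (LinearMap.range (toHyDual 𝒜).toLinearMap) := by
  rintro _ ⟨a, rfl⟩
  have h1 : TensorProduct.map (toHyDual 𝒜).toLinearMap (toHyDual 𝒜).toLinearMap
      (comul (R := k) a) = comul (R := k) ((toHyDual 𝒜).toLinearMap a) :=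
    CoalgHomClass.map_comp_comul_apply (toHyDual 𝒜) a
  have h2 : (FiniteDual.map (hyIncl 𝒜)).toLinearMap ∘ₗ (toHyDual 𝒜).toLinearMap =
      (toHyEvDual 𝒜).toLinearMap ∘ₗ (evMk 𝒜).toLinearMap := rfl
  rw [hyDualComodule_coact, ← h1]
  exact rTensor_map_mem_range h2 _

/-- The elements of an `O(G_ev)`-subcomodule of `hy(G)°` factor through `O(G_ev)` along
`hy(G_ev)`. -/
theorem exists_factor {N : Submodule k (HyDual 𝒜)}
    (hN : (hyDualComodule 𝒜).IsSubcomoduleOver (toHyEvDual 𝒜) N) {f : HyDual 𝒜} (hf : f ∈ N) :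
    ∃ F : hy 𝒜 → EvQuot 𝒜, ∀ (x : hyEv 𝒜) (y : hy 𝒜),
      f.1 (hyIncl 𝒜 x * y) = x.1.ofConv (F y) := by
  obtain ⟨t, ht⟩ := hN f hf
  obtain ⟨F, hF⟩ := exists_pairing_map_eq (FiniteDual k (hyEv 𝒜)).subtype
    (FiniteDual k (hy 𝒜)).subtype (toHyEvDual 𝒜).toLinearMap N t
  refine ⟨F, fun x y => ?_⟩
  have h1 := hF x y
  rw [ht, hyDualComodule_coact] at h1
  have h2 := pairing_rTensor_tmul (e := (FiniteDual k (hyEv 𝒜)).subtype)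
    (e' := (FiniteDual k (hy 𝒜)).subtype) (ρ := (FiniteDual.map (hyIncl 𝒜)).toLinearMap)
    (i := hyIncl 𝒜) (fun _ _ => rfl) (comul (R := k) f) x y
  exact (FiniteDual.pair_comul_tmul f (hyIncl 𝒜 x) y).symm.trans (h2.symm.trans h1)

end Comodule

end SuperGroup

theorem lemma7p1 {k : Type*} [Field k] (hk : ringChar k ≠ 2) {A : Type*} [Ring A] [Algebra k A]
    (𝒜 : ZMod 2 → Submodule k A) [GradedAlgebra 𝒜] [Coalgebra k A]
    [SuperGroup.IsSuperHopfAlgebra 𝒜] [SuperGroup.SuperCommutative 𝒜] [Algebra.FiniteType k A]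
    (hconn : SuperGroup.IsConnectedGroup 𝒜) :
    Function.Injective (SuperGroup.toHyDual 𝒜) ∧
    Function.Injective (SuperGroup.toHyEvDual 𝒜) ∧
    IsGreatest
      {N : Submodule k (SuperGroup.HyDual 𝒜) |
        (SuperGroup.hyDualComodule 𝒜).IsSubcomoduleOver (SuperGroup.toHyEvDual 𝒜) N}
      (LinearMap.range (SuperGroup.toHyDual 𝒜).toLinearMap) := by
  have hev := SuperGroup.toHyEvDual_injective 𝒜 hk hconn
  refine ⟨SuperGroup.toHyDual_injective 𝒜 hk hev, hev,
    SuperGroup.isSubcomoduleOver_range 𝒜, fun N hN f hf => ?_⟩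
  obtain ⟨F, hF⟩ := SuperGroup.exists_factor 𝒜 hN hf
  obtain ⟨a, ha⟩ := SuperGroup.exists_eq_eval 𝒜 hk f.1 F hF
  exact ⟨a, Subtype.ext (LinearMap.ext fun y => (ha y).symm)⟩

end
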